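/- Let $\mathbb{D}$ be the open unit disk. For $\gamma\ge -1$ let $A^2_\gamma$ be the reproducing kernel Hilbert space on $\mathbb{D}$ with kernel $k_w(z)=(1-\bar w z)^{-(\gamma+2)}$; thus $A^2_{-1}$ is the Hardy space $H^2$, and for $\gamma>-1$, $A^2_\gamma$ is the space of analytic functions on $\mathbb{D}$ that are square-integrable with respect to $dA_\gamma(z)=(\gamma+1)(1-|z|^2)^\gamma\,dA(z)$, where $dA$ is the area measure normalized so that $\mathbb{D}$ has area $1$. For $\gamma>-1$ and $\varphi\in L^\infty(\mathbb{D})$ let $T^\gamma_\varphi f=P_\gamma(\varphi f)$ be the Toeplitz operator on $A^2_\gamma$, where $P_\gamma$ is the orthogonal projection of $L^2(\mathbb{D},dA_\gamma)$ onto $A^2_\gamma$. For an analytic function $b$ on $\mathbb{D}$ with $|b|\le 1$ (that is, $b$ in the closed unit ball of $H^\infty$), the weighted sub-Bergman space $\mathcal{A}_\gamma(b)$ is the range of the operator $(I-T^\gamma_b T^\gamma_{\bar b})^{1/2}$ on $A^2_\gamma$. Theorem. Let $b$ be a non-constant function in the closed unit ball of $H^\infty$. For every real $\alpha\ge 0$,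 $$A^2_{\alpha-1}\subset\mathcal{A}_\alpha(b).$$ In particular, for $\alpha=0$, $H^2\subset\mathcal{A}_0(b)$. -/

import Mathlib

open MeasureTheory Complex Filter Topology
open scoped ENNReal ComplexConjugate InnerProductSpace

namespace SubBergman

/-- The open unit disk, as a type. -/
abbrev Disk : Type := ↥(Metric.ball (0 : ℂ) 1)

lemma Disk.norm_lt_one (z : Disk) : ‖(z : ℂ)‖ < 1 :=
  mem_ball_zero_iff.mp z.2

/-- `f` is analytic on the unit disk. -/
def IsAnalytic (f : Disk → ℂ) : Prop :=
  ∃ F : ℂ → ℂ, DifferentiableOn ℂ F (Metric.ball 0 1) ∧ ∀ z : Disk, f z = F z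

/-- `b` lies in the closed unit ball of `H^∞`. -/
structure InHInftyBall (b : Disk → ℂ) : Prop where
  analytic : IsAnalytic b
  norm_le_one : ∀ z, ‖b z‖ ≤ 1

lemma IsAnalytic.continuous {f : Disk → ℂ} (hf : IsAnalytic f) : Continuous f := by
  obtain ⟨F, hF, h⟩ := hf
  have : f = (Metric.ball (0 : ℂ) 1).domRestrict F := funext h
  rw [this]
  exact hF.continuousOn.domRestrict

/-! ### The spaces `A²_γ`, `γ ≥ -1`, as reproducing kernel Hilbert spaces -/

/-- The kernel `(z, w) ↦ 1 / (1 - \bar w z)^(γ + 2)` (principal branch; `Re (1 - \bar w z) > 0`),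
a scalar `c` being viewed as the operator `c • 1` on `ℂ`. -/
noncomputable def kernel (γ : ℝ) : Matrix Disk Disk (ℂ →L[ℂ] ℂ) :=
  Matrix.of fun z w => (1 / (1 - conj (w : ℂ) * (z : ℂ)) ^ ((γ : ℂ) + 2)) • (1 : ℂ →L[ℂ] ℂ)

lemma multichoose_nonneg {s : ℝ} (hs : 0 < s) (n : ℕ) : 0 ≤ Ring.choose (s + n - 1) n := by
  have h := Ring.factorial_nsmul_multichoose_eq_ascPochhammer s n
  rw [Ring.multichoose_eq] at h
  rw [Polynomial.ascPochhammer_smeval_eq_eval] at h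
  have h2 := ascPochhammer_pos n s hs
  rw [← h, nsmul_eq_mul] at h2
  exact (pos_of_mul_pos_right h2 (by positivity)).le

lemma hasSum_kernel {s : ℝ} {x : ℂ} (hx : ‖x‖ < 1) :
    HasSum (fun n : ℕ => ((Ring.choose (s + n - 1) n : ℝ) : ℂ) * x ^ n)
      (1 / (1 - x) ^ (s : ℂ)) := by
  have h := (Complex.one_div_one_sub_cpow_hasFPowerSeriesOnBall_zero (s : ℂ)).hasSum (y := x)
    (by simpa [enorm_eq_nnnorm] using (by exact_mod_cast hx : ‖x‖₊ < 1))
  simpa [FormalMultilinearSeries.ofScalars_apply_eq, Complex.ofReal_choose, mul_comm] using h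

open scoped ComplexOrder in
lemma kernel_posSemidef {γ : ℝ} (hγ : -1 ≤ γ) : (kernel γ).PosSemidef := by
  have hs : 0 < γ + 2 := by linarith
  have key (z w : Disk) : HasSum (fun n : ℕ => ((Ring.choose (γ + 2 + n - 1) n : ℝ) : ℂ) *
      (conj (w : ℂ) * (z : ℂ)) ^ n) (1 / (1 - conj (w : ℂ) * (z : ℂ)) ^ ((γ : ℂ) + 2)) := by
    have := hasSum_kernel (s := γ + 2) (x := conj (w : ℂ) * (z : ℂ)) (by
      rw [norm_mul, Complex.norm_conj]
      nlinarith [w.norm_lt_one, z.norm_lt_one, norm_nonneg (w : ℂ), norm_nonneg (z : ℂ)])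
    simpa using this
  have hconj (z w : Disk) : conj (1 / (1 - conj (w : ℂ) * (z : ℂ)) ^ ((γ : ℂ) + 2))
      = 1 / (1 - conj (z : ℂ) * (w : ℂ)) ^ ((γ : ℂ) + 2) := by
    have h1 := (key z w).map (starRingEnd ℂ) Complex.continuous_conj
    refine h1.unique ?_
    convert key w z using 2 with n
    simp [mul_comm]
  have tfae := (RKHS.posSemidef_tfae (K := kernel γ)).out 0 2
  rw [tfae]
  refine ⟨?_, fun vv => ?_⟩
  · ext z w : 2
    simp only [Matrix.conjTranspose_apply, kernel, Matrix.of_apply, star_smul, star_one]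
    exact congrArg (fun c : ℂ => (c • (1 : ℂ →L[ℂ] ℂ)) 1) (hconj w z)
  · have hsum : HasSum (fun n : ℕ => ((Ring.choose (γ + 2 + n - 1) n : ℝ) : ℂ) *
        (conj (vv.sum fun x w => conj (x : ℂ) ^ n * w) * (vv.sum fun x w => conj (x : ℂ) ^ n * w)))
        (vv.sum fun x w => vv.sum fun x' w' => ⟪kernel γ x' x w, w'⟫_ℂ) := by
      simp only [Finsupp.sum]
      have : ∀ i ∈ vv.support, ∀ j ∈ vv.support,
          HasSum (fun n : ℕ => ((Ring.choose (γ + 2 + n - 1) n : ℝ) : ℂ) *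
            ((conj (conj (i : ℂ) ^ n * vv i)) * (conj (j : ℂ) ^ n * vv j)))
            ⟪kernel γ j i (vv i), vv j⟫_ℂ := by
        intro i _ j _
        have h := (key i j).mul_right (conj (vv i) * vv j)
        have e : (kernel γ j i) (vv i)
            = (1 / (1 - conj (i : ℂ) * (j : ℂ)) ^ ((γ : ℂ) + 2)) * vv i := rfl
        have e2 : ⟪kernel γ j i (vv i), vv j⟫_ℂ
            = 1 / (1 - conj (j : ℂ) * (i : ℂ)) ^ ((γ : ℂ) + 2) * (conj (vv i) * vv j) := by
          rw [e, RCLike.inner_apply, map_mul, hconj j i]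
          ring
        rw [e2]
        refine (congrArg (fun g : ℕ → ℂ => HasSum g _) (funext fun n => ?_)).mp h
        simp only [mul_pow, map_mul, map_pow, Complex.conj_conj]
        ring
      have h2 := hasSum_sum fun i hi => hasSum_sum (this i hi)
      convert h2 using 2 with n
      rw [map_sum, Finset.sum_mul_sum, Finset.mul_sum]
      exact Finset.sum_congr rfl fun i _ => by rw [Finset.mul_sum]
    have hre := hsum.mapL Complex.reCLM
    refine hre.nonneg fun n => ?_
    have := multichoose_nonneg hs n
    rw [← Complex.normSq_eq_conj_mul_self, ← Complex.ofReal_mul]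
    exact mul_nonneg this (Complex.normSq_nonneg _)

/-- The space `A²_γ`, `γ ≥ -1`: the set of functions belonging to the reproducing kernel Hilbert
space on the disk whose kernel is `1 / (1 - \bar w z)^(γ + 2)`. -/
noncomputable def kernelSpace (γ : ℝ) (hγ : -1 ≤ γ) : Set (Disk → ℂ) :=
  haveI : Fact (kernel γ).PosSemidef := ⟨kernel_posSemidef hγ⟩
  Set.range fun f : RKHS.OfKernel (kernel γ) => (⇑f : Disk → ℂ)

/-! ### Weighted Bergman spaces, Toeplitz operators, sub-Bergman spaces -/

/-- The measure `dA_α = (α + 1) (1 - |z|²)^α dA` on the disk, `dA` being the normalized area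
measure (Lebesgue measure divided by `π`). -/
noncomputable def areaMeasure (α : ℝ) : Measure Disk :=
  (Measure.comap ((↑) : Disk → ℂ) (volume : Measure ℂ)).withDensity fun z =>
    ENNReal.ofReal ((α + 1) * (1 - ‖(z : ℂ)‖ ^ 2) ^ α / Real.pi)

/-- The Bergman space of analytic functions that are square-integrable for `dA_α`, as a subspace
of `L²(dA_α)`. -/
noncomputable def bergman (α : ℝ) : Submodule ℂ (Lp ℂ 2 (areaMeasure α)) where
  carrier := {u | ∃ f : Disk → ℂ, IsAnalytic f ∧ u =ᵐ[areaMeasure α] f}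
  zero_mem' := ⟨fun _ => 0, ⟨fun _ => 0, differentiableOn_const 0, fun _ => rfl⟩,
    Lp.coeFn_zero ..⟩
  add_mem' := by
    rintro u v ⟨f, ⟨F, hF, hfF⟩, huf⟩ ⟨g, ⟨G, hG, hgG⟩, hvg⟩
    exact ⟨f + g, ⟨F + G, hF.add hG, fun z => by simp [hfF, hgG]⟩,
      (Lp.coeFn_add u v).trans (huf.add hvg)⟩
  smul_mem' := by
    rintro c u ⟨f, ⟨F, hF, hfF⟩, huf⟩
    exact ⟨c • f, ⟨c • F, hF.const_smul c, fun z => by simp [hfF]⟩,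
      (Lp.coeFn_smul c u).trans (huf.const_smul c)⟩

/-- Area sub-mean value inequality for `|F|²`. -/
lemma sq_le_lintegral {F : ℂ → ℂ} {z : ℂ} {R : ℝ} (hR : 0 < R)
    (hF : DifferentiableOn ℂ F (Metric.ball z R)) :
    ENNReal.ofReal (Real.pi * R ^ 2) * ‖F z‖ₑ ^ 2 ≤
      ∫⁻ w in Metric.ball z R, ‖F w‖ₑ ^ 2 := by
  have hpi := Real.pi_pos
  -- the circle mean value inequality
  have hcirc : ∀ r ∈ Set.Ioo 0 R, ENNReal.ofReal (2 * Real.pi) * ‖F z‖ₑ ^ 2 ≤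
      ∫⁻ θ in Set.Ioo (-Real.pi) Real.pi, ‖F (circleMap z r θ)‖ₑ ^ 2 := by
    intro r hr
    have hd : DiffContOnCl ℂ (fun w => F w ^ 2) (Metric.ball z |r|) := by
      rw [abs_of_pos hr.1]
      apply DifferentiableOn.diffContOnCl
      refine (hF.pow 2).mono ?_
      rw [closure_ball z hr.1.ne']
      exact Metric.closedBall_subset_ball hr.2
    have h1 := hd.circleAverage
    rw [Real.circleAverage_eq_integral_add (-Real.pi),
      intervalIntegral.integral_comp_add_right (fun θ => F (circleMap z r θ) ^ 2)] at h1
    have e1 : (0 : ℝ) + -Real.pi = -Real.pi := by ring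
    have e2 : 2 * Real.pi + -Real.pi = Real.pi := by ring
    rw [e1, e2, intervalIntegral.integral_of_le (by linarith), integral_Ioc_eq_integral_Ioo] at h1
    have h2 : ∫ θ in Set.Ioo (-Real.pi) Real.pi, F (circleMap z r θ) ^ 2
        = (2 * Real.pi) • F z ^ 2 := by
      rw [← h1, smul_smul, mul_inv_cancel₀ (by positivity), one_smul]
    have h3 := enorm_integral_le_lintegral_enorm
      (μ := volume.restrict (Set.Ioo (-Real.pi) Real.pi)) (fun θ => F (circleMap z r θ) ^ 2)
    rw [h2, enorm_smul, Real.enorm_eq_ofReal (by positivity)] at h3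
    simpa [enorm_pow] using h3
  set G : ℂ → ℝ≥0∞ := (Metric.ball z R).indicator fun w => ‖F w‖ₑ ^ 2 with hG
  have hGm : Measurable G := by
    classical
    have hc : ContinuousOn (fun w => ‖F w‖ₑ ^ 2) (Metric.ball z R) :=
      (ENNReal.continuous_pow 2).comp_continuousOn (continuous_enorm.comp_continuousOn hF.continuousOn)
    have := hc.measurable_piecewise (g := fun _ => 0) continuousOn_const measurableSet_ball
    rw [hG, ← Set.piecewise_eq_indicator]
    exact this
  rw [← lintegral_indicator measurableSet_ball, ← hG, ← lintegral_add_left_eq_self G z,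
    ← Complex.lintegral_comp_polarCoord_symm, polarCoord_target,
    Measure.volume_eq_prod, ← Measure.prod_restrict, lintegral_prod]
  · have hid : ∫⁻ r in Set.Ioo 0 R, ENNReal.ofReal r = ENNReal.ofReal (R ^ 2 / 2) := by
      rw [← ofReal_integral_eq_lintegral_ofReal]
      · rw [← integral_Ioc_eq_integral_Ioo, ← intervalIntegral.integral_of_le hR.le, integral_id]
        congr 1; ring
      · exact (continuous_id.integrableOn_Icc (a := 0) (b := R)).mono_set Set.Ioo_subset_Icc_self
      · filter_upwards [ae_restrict_mem measurableSet_Ioo] with r hr using hr.1.le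
    calc ENNReal.ofReal (Real.pi * R ^ 2) * ‖F z‖ₑ ^ 2
        = ∫⁻ r in Set.Ioo 0 R,
            ENNReal.ofReal r * (ENNReal.ofReal (2 * Real.pi) * ‖F z‖ₑ ^ 2) := by
          rw [lintegral_mul_const _ (by fun_prop), hid, ← mul_assoc,
            ← ENNReal.ofReal_mul (by positivity)]
          congr 2; ring
      _ ≤ ∫⁻ r in Set.Ioo 0 R, ∫⁻ θ in Set.Ioo (-Real.pi) Real.pi,
            ENNReal.ofReal r • G (z + Complex.polarCoord.symm (r, θ)) := by
          refine lintegral_mono_ae ?_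
          filter_upwards [ae_restrict_mem measurableSet_Ioo] with r hr
          simp only [smul_eq_mul]
          rw [lintegral_const_mul' _ _ ENNReal.ofReal_ne_top]
          gcongr
          refine (hcirc r hr).trans (le_of_eq (lintegral_congr fun θ => ?_))
          have e : z + Complex.polarCoord.symm (r, θ) = circleMap z r θ := by
            simp [circleMap, Complex.polarCoord_symm_apply, Complex.exp_mul_I]
          rw [e, hG, Set.indicator_of_mem]
          rw [Metric.mem_ball, dist_eq_norm]
          simp [circleMap, abs_of_pos hr.1, hr.2]
      _ ≤ _ := lintegral_mono_set Set.Ioo_subset_Ioi_self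
  · refine Measurable.aemeasurable ?_
    refine Measurable.smul (ENNReal.measurable_ofReal.comp measurable_fst)
      (hGm.comp (measurable_const.add ?_))
    have e : (Complex.polarCoord.symm : ℝ × ℝ → ℂ) =
        fun p => (p.1 : ℂ) * (Real.cos p.2 + Real.sin p.2 * I) :=
      funext Complex.polarCoord_symm_apply
    rw [e]
    fun_prop

/-- Point evaluations are bounded for the weighted area norm, uniformly on compact sets. -/
lemma sq_le_areaMeasure {α : ℝ} (hα : -1 < α) {ρ : ℝ} (hρ : ρ < 1) :
    ∃ C : ℝ≥0∞, C ≠ ∞ ∧ ∀ F : ℂ → ℂ, DifferentiableOn ℂ F (Metric.ball 0 1) →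
      ∀ z ∈ Metric.closedBall (0 : ℂ) ρ,
        ‖F z‖ₑ ^ 2 ≤ C * ∫⁻ w : Disk, ‖F w‖ₑ ^ 2 ∂areaMeasure α := by
  have hpi := Real.pi_pos
  set R : ℝ := (1 - ρ) / 2 with hRdef
  have hR : 0 < R := by simp only [hRdef]; linarith
  set σ : ℝ := (1 + ρ) / 2 with hσ
  by_cases hρ0 : 0 ≤ ρ
  swap
  · refine ⟨0, by simp, fun F _ z hz => ?_⟩
    rw [Metric.closedBall_eq_empty.mpr (not_le.mp hρ0)] at hz
    exact hz.elim
  have hσ1 : σ < 1 := by simp only [hσ]; linarith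
  have hσ0 : 0 ≤ σ := by simp only [hσ]; linarith
  have hden : 0 < 1 - σ ^ 2 := by nlinarith
  -- a lower bound for the weight on the disk of radius `σ`
  set m : ℝ := (α + 1) * min ((1 - σ ^ 2) ^ α) 1 / Real.pi with hm
  have hm0 : 0 < m := by
    have : 0 < α + 1 := by linarith
    have := Real.rpow_pos_of_pos hden α
    positivity
  have hw : ∀ w : Disk, ‖(w : ℂ)‖ ≤ σ →
      m ≤ (α + 1) * (1 - ‖(w : ℂ)‖ ^ 2) ^ α / Real.pi := by
    intro w hwσ
    have h1 : 1 - σ ^ 2 ≤ 1 - ‖(w : ℂ)‖ ^ 2 := by nlinarith [norm_nonneg (w : ℂ)]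
    have h2 : 1 - ‖(w : ℂ)‖ ^ 2 ≤ 1 := by nlinarith [norm_nonneg (w : ℂ)]
    have : 0 ≤ α + 1 := by linarith
    simp only [hm]
    gcongr
    rcases le_total 0 α with h | h
    · exact (min_le_left _ _).trans (Real.rpow_le_rpow hden.le h1 h)
    · exact (min_le_right _ _).trans
        (Real.one_le_rpow_of_pos_of_le_one_of_nonpos (by linarith) h2 h)
  refine ⟨(ENNReal.ofReal (Real.pi * R ^ 2))⁻¹ * (ENNReal.ofReal m)⁻¹, ?_, fun F hF z hz => ?_⟩
  · refine ENNReal.mul_ne_top ?_ ?_ <;> simp <;> positivity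
  have hzρ : ‖z‖ ≤ ρ := by simpa using hz
  have hsub : ∀ w ∈ Metric.ball z R, ‖w‖ < σ := by
    intro w hw
    rw [Metric.mem_ball, dist_eq_norm] at hw
    calc ‖w‖ = ‖(w - z) + z‖ := by ring_nf
      _ ≤ ‖w - z‖ + ‖z‖ := norm_add_le _ _
      _ < R + ρ := by linarith
      _ = σ := by simp only [hRdef, hσ]; ring
  have hball : Metric.ball z R ⊆ Metric.ball 0 1 := fun w hw => by
    simpa using (hsub w hw).trans hσ1
  have h1 := sq_le_lintegral hR (hF.mono hball)
  have hcont : Measurable fun w : Disk => ‖F w‖ₑ ^ 2 := by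
    have : Continuous fun w : Disk => F w :=
      IsAnalytic.continuous ⟨F, hF, fun _ => rfl⟩
    exact ((ENNReal.continuous_pow 2).comp (continuous_enorm.comp this)).measurable
  have h2 : ENNReal.ofReal m * ∫⁻ w in Metric.ball z R, ‖F w‖ₑ ^ 2 ≤
      ∫⁻ w : Disk, ‖F w‖ₑ ^ 2 ∂areaMeasure α := by
    rw [areaMeasure, lintegral_withDensity_eq_lintegral_mul₀ (by fun_prop) hcont.aemeasurable]
    have e : ∫⁻ w in Metric.ball z R, ‖F w‖ₑ ^ 2
        = ∫⁻ w : Disk, (Metric.ball z R).indicator (fun w => ‖F w‖ₑ ^ 2) (w : ℂ)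
            ∂(Measure.comap ((↑) : Disk → ℂ) (volume : Measure ℂ)) := by
      rw [lintegral_subtype_comap measurableSet_ball
        ((Metric.ball z R).indicator (fun w => ‖F w‖ₑ ^ 2)),
        setLIntegral_indicator measurableSet_ball,
        Set.inter_eq_left.mpr hball]
    rw [e, ← lintegral_const_mul' _ _ ENNReal.ofReal_ne_top]
    refine lintegral_mono fun w => ?_
    by_cases hwz : (w : ℂ) ∈ Metric.ball z R
    · simp only [Set.indicator_of_mem hwz, Pi.mul_apply]
      gcongr
      exact hw w (hsub w hwz).le
    · simp [Set.indicator_of_notMem hwz]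
  have p1 : ENNReal.ofReal (Real.pi * R ^ 2) ≠ 0 := by simp; positivity
  have p2 : ENNReal.ofReal m ≠ 0 := by simpa using hm0
  calc ‖F z‖ₑ ^ 2
      = (ENNReal.ofReal (Real.pi * R ^ 2))⁻¹ *
          (ENNReal.ofReal (Real.pi * R ^ 2) * ‖F z‖ₑ ^ 2) := by
        rw [← mul_assoc, ENNReal.inv_mul_cancel p1 ENNReal.ofReal_ne_top, one_mul]
    _ ≤ (ENNReal.ofReal (Real.pi * R ^ 2))⁻¹ * ∫⁻ w in Metric.ball z R, ‖F w‖ₑ ^ 2 := by gcongr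
    _ = (ENNReal.ofReal (Real.pi * R ^ 2))⁻¹ * ((ENNReal.ofReal m)⁻¹ *
          (ENNReal.ofReal m * ∫⁻ w in Metric.ball z R, ‖F w‖ₑ ^ 2)) := by
        rw [← mul_assoc (ENNReal.ofReal m)⁻¹, ENNReal.inv_mul_cancel p2 ENNReal.ofReal_ne_top,
          one_mul]
    _ ≤ _ := by rw [mul_assoc]; gcongr

lemma isClosed_bergman (α : ℝ) : IsClosed (bergman α : Set (Lp ℂ 2 (areaMeasure α))) := by
  rcases le_or_gt α (-1) with hα | hα
  · -- here the measure is zero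
    have h0 : areaMeasure α = 0 := by
      rw [areaMeasure]
      have hz : (fun z : Disk => ENNReal.ofReal ((α + 1) * (1 - ‖(z : ℂ)‖ ^ 2) ^ α / Real.pi)) = 0 := ?_
      · rw [hz, withDensity_zero]
      funext z
      have h1 : 0 ≤ (1 - ‖(z : ℂ)‖ ^ 2) ^ α :=
        Real.rpow_nonneg (by nlinarith [z.norm_lt_one, norm_nonneg (z : ℂ)]) _
      simp only [Pi.zero_apply, ENNReal.ofReal_eq_zero]
      exact div_nonpos_of_nonpos_of_nonneg
        (mul_nonpos_of_nonpos_of_nonneg (by linarith) h1) Real.pi_pos.le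
    have : (bergman α : Set (Lp ℂ 2 (areaMeasure α))) = Set.univ := by
      refine Set.eq_univ_of_forall fun u => ⟨fun _ => 0, ⟨fun _ => 0, differentiableOn_const 0,
        fun _ => rfl⟩, ?_⟩
      have : ae (areaMeasure α) = ⊥ := ae_eq_bot.mpr h0
      rw [Filter.EventuallyEq, this]
      exact Filter.eventually_bot
    rw [this]
    exact isClosed_univ
  refine IsSeqClosed.isClosed fun u v hu huv => ?_
  choose f hf huf using hu
  choose F hF hfF using hf
  have hdiff (n k : ℕ) :
      ∫⁻ w : Disk, ‖F n w - F k w‖ₑ ^ 2 ∂areaMeasure α = ‖u n - u k‖ₑ ^ 2 := by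
    rw [Lp.enorm_def, eLpNorm_eq_lintegral_rpow_enorm_toReal (by simp) (by simp)]
    rw [← ENNReal.rpow_natCast, ← ENNReal.rpow_mul]
    have e1 : (1 / ENNReal.toReal 2 * ((2 : ℕ) : ℝ)) = 1 := by norm_num
    rw [e1, ENNReal.rpow_one]
    have e2 : ENNReal.toReal 2 = ((2 : ℕ) : ℝ) := by norm_num
    simp only [e2, ENNReal.rpow_natCast]
    refine lintegral_congr_ae ?_
    filter_upwards [huf n, huf k, Lp.coeFn_sub (u n) (u k)] with w h1 h2 h3
    rw [h3, Pi.sub_apply, h1, h2, hfF, hfF]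
  have hcauchy := huv.cauchySeq
  have hunif (ρ : ℝ) (hρ : ρ < 1) :
      UniformCauchySeqOn F atTop (Metric.closedBall (0 : ℂ) ρ) := by
    obtain ⟨C, hC, hCF⟩ := sq_le_areaMeasure hα hρ
    rw [Metric.uniformCauchySeqOn_iff]
    intro ε hε
    have hc := ENNReal.toReal_nonneg (a := C)
    obtain ⟨N, hN⟩ := Metric.cauchySeq_iff.mp hcauchy (ε / (C.toReal + 1)) (by positivity)
    refine ⟨N, fun n hn k hk z hz => ?_⟩
    have h1 := hCF (fun w => F n w - F k w) ((hF n).sub (hF k)) z hz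
    rw [hdiff n k] at h1
    have h2 := ENNReal.toReal_mono (by finiteness) h1
    simp only [ENNReal.toReal_mul, ENNReal.toReal_pow, toReal_enorm] at h2
    have h3 := hN n hn k hk
    rw [dist_eq_norm] at h3 ⊢
    have h4 : ‖u n - u k‖ ^ 2 ≤ (ε / (C.toReal + 1)) ^ 2 := by gcongr
    have h5 : C.toReal * (ε / (C.toReal + 1)) ^ 2 < ε ^ 2 := by
      rw [div_pow, mul_div_assoc', div_lt_iff₀ (by positivity)]
      nlinarith [pow_pos hε 2, mul_nonneg (pow_pos hε 2).le (sq_nonneg C.toReal),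
        mul_nonneg (pow_pos hε 2).le hc]
    refine lt_of_pow_lt_pow_left₀ 2 hε.le ?_
    calc ‖F n z - F k z‖ ^ 2 ≤ C.toReal * ‖u n - u k‖ ^ 2 := h2
      _ ≤ C.toReal * (ε / (C.toReal + 1)) ^ 2 := by gcongr
      _ < ε ^ 2 := h5
  have hlim (z : ℂ) (hz : z ∈ Metric.ball (0 : ℂ) 1) :
      ∃ l, Tendsto (fun n => F n z) atTop (𝓝 l) := by
    have hz1 : ‖z‖ < 1 := by simpa using hz
    exact cauchySeq_tendsto_of_complete ((hunif ‖z‖ hz1).cauchySeq (by simp))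
  choose! G hG using hlim
  have hloc : TendstoLocallyUniformlyOn F G atTop (Metric.ball 0 1) := by
    rw [tendstoLocallyUniformlyOn_iff_forall_isCompact Metric.isOpen_ball]
    intro K hK hKc
    obtain ⟨ρ, hρ, hKρ⟩ : ∃ ρ < (1 : ℝ), K ⊆ Metric.closedBall 0 ρ := by
      obtain ⟨ρ, hρ, h⟩ := exists_lt_subset_ball hKc.isClosed hK
      exact ⟨ρ, hρ, h.trans Metric.ball_subset_closedBall⟩
    exact ((hunif ρ hρ).mono hKρ).tendstoUniformlyOn_of_tendsto fun z hz => hG z (hK hz)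
  have hGd := hloc.differentiableOn (Eventually.of_forall hF) Metric.isOpen_ball
  refine ⟨fun z => G z, ⟨G, hGd, fun _ => rfl⟩, ?_⟩
  obtain ⟨φ, hφ, hφv⟩ := (tendstoInMeasure_of_tendsto_Lp huv).exists_seq_tendsto_ae
  filter_upwards [hφv, ae_all_iff.mpr huf] with z h1 h2
  refine tendsto_nhds_unique h1 (((hG z z.2).comp hφ.tendsto_atTop).congr fun n => ?_)
  simp [h2, hfF]

instance (α : ℝ) : CompleteSpace (bergman α) := (isClosed_bergman α).completeSpace_coe

/-- Multiplication by the bounded function `φ` on `L²(dA_α)`. -/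
noncomputable def mulOp (α : ℝ) (φ : Disk → ℂ) (hφ : MemLp φ ∞ (areaMeasure α)) :
    Lp ℂ 2 (areaMeasure α) →L[ℂ] Lp ℂ 2 (areaMeasure α) :=
  (ContinuousLinearMap.mul ℂ ℂ).holderL (areaMeasure α) ∞ 2 2 (hφ.toLp φ)

/-- The Toeplitz operator `T_φ f = P_α (φ f)` on the Bergman space, `P_α` being the orthogonal
projection of `L²(dA_α)` onto it. -/
noncomputable def toeplitz (α : ℝ) (φ : Disk → ℂ) (hφ : MemLp φ ∞ (areaMeasure α)) :
    bergman α →L[ℂ] bergman α :=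
  (bergman α).orthogonalProjectionOnto ∘L mulOp α φ hφ ∘L (bergman α).subtypeL

/-- The underlying vector space of the range space `M_H(A) = A H`. -/
noncomputable def rangeSpace {H : Type*} [NormedAddCommGroup H] [InnerProductSpace ℂ H]
    (A : H →L[ℂ] H) : Submodule ℂ H := LinearMap.range (A : H →ₗ[ℂ] H)

lemma InHInftyBall.memLp {b : Disk → ℂ} (hb : InHInftyBall b) (α : ℝ) :
    MemLp b ∞ (areaMeasure α) :=
  memLp_top_of_bound hb.analytic.continuous.aestronglyMeasurable 1
    (Eventually.of_forall hb.norm_le_one)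

lemma InHInftyBall.memLp_conj {b : Disk → ℂ} (hb : InHInftyBall b) (α : ℝ) :
    MemLp (fun z => conj (b z)) ∞ (areaMeasure α) :=
  memLp_top_of_bound
    (Complex.continuous_conj.comp hb.analytic.continuous).aestronglyMeasurable 1
    (Eventually.of_forall fun z => by simpa using hb.norm_le_one z)

/-- The positive square root of a positive operator. -/
noncomputable def opSqrt {H : Type*} [NormedAddCommGroup H] [InnerProductSpace ℂ H]
    [CompleteSpace H] (A : H →L[ℂ] H) : H →L[ℂ] H := CFC.sqrt A

/-- The operator `I - T_b T_{\bar b}` on the weighted Bergman space. -/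
noncomputable def defect (α : ℝ) (b : Disk → ℂ) (hb : InHInftyBall b) :
    bergman α →L[ℂ] bergman α :=
  1 - toeplitz α b (hb.memLp α) ∘L toeplitz α (fun z => conj (b z)) (hb.memLp_conj α)

/-- The weighted sub-Bergman space `A_α(b) = M((I - T_b T_{\bar b})^{1/2})`, as a set of analytic
functions on the disk. -/
noncomputable def subBergman (α : ℝ) (b : Disk → ℂ) (hb : InHInftyBall b) : Set (Disk → ℂ) :=
  {f | IsAnalytic f ∧ ∃ u ∈ rangeSpace (opSqrt (defect α b hb)),
    (u : Lp ℂ 2 (areaMeasure α)) =ᵐ[areaMeasure α] f}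

end SubBergman

/-! Everything is an inequality between kernels, where K ≤ L means that the quadratic forms of L - K
have nonnegative real part. Write k_s(z,w) = (1 - \bar w z)^(-s) and D = I - T_b T_{\bar b}. A
function f in A²_{α-1} satisfies f(z) \bar f(w) ≤ ‖f‖² k_{α+1}, while ⟨k_z, D k_w⟩ = (1 - b(z) \bar
b(w)) k_{α+2}(z,w) for the Bergman kernel functions k_w. If k_{α+1} ≤ C (1 - b \bar b) k_{α+2}, then
f is dominated by the Gram matrix of the vectors D^{1/2} k_w. Hahn–Banach and Riesz then give x with
⟨D^{1/2} k_w, x⟩ = f(w), that is, f = D^{1/2} x (`exists_inner_eq_of_bound`,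
`exists_opSqrt_inner_eq`).

The domination is `InHInftyBall.exists_quadForm_kernelPow_le`. Put β = b(0), g = 1 - \bar β b, p = 1
- |β|², q = 1 - |β|; since b is not constant, |β| < 1. The kernel K_b = (1 - b \bar b) k_1 is
positive, and Cauchy–Schwarz against the origin gives g \bar g ≤ p K_b. As |g| ≥ q, the function q/g
is in the unit ball too, and positivity of its kernel gives q² k_1 ≤ g \bar g k_1. Schur products
with k_{α+1} and k_α respectively turn these into q² k_{α+1} ≤ g \bar g k_{α+1} ≤ p (1 - b \bar b)
k_{α+2}.

The formula for ⟨k_z, D k_w⟩ rests on the reproducing property of k_{α+2} for dA_α, which comes from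
the radial moments of the weight. -/

namespace SubBergman

/-! ### Positive kernels on the disk -/

/-- The quadratic form `∑ \bar c_i c_j K(w_i, w_j)`. -/
noncomputable def quadForm {ι : Type} [Fintype ι] (K : Disk → Disk → ℂ) (w : ι → Disk)
    (c : ι → ℂ) : ℂ :=
  ∑ i, ∑ j, conj (c i) * c j * K (w i) (w j)

/-- Positivity of the real parts of all the quadratic forms of a kernel. -/
def IsPosKernel (K : Disk → Disk → ℂ) : Prop :=
  ∀ (ι : Type) [Fintype ι] (w : ι → Disk) (c : ι → ℂ), 0 ≤ (quadForm K w c).re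

/-- The kernel `(1 - \bar w z)^(-s)`. -/
noncomputable def kernelPow (s : ℝ) (z w : Disk) : ℂ :=
  1 / (1 - conj (w : ℂ) * (z : ℂ)) ^ (s : ℂ)

/-- The de Branges–Rovnyak kernel of `h`. -/
noncomputable def dbrKernel (h : Disk → ℂ) (z w : Disk) : ℂ :=
  (1 - h z * conj (h w)) / (1 - conj (w : ℂ) * (z : ℂ))

lemma norm_conj_mul_lt_one (z w : Disk) : ‖conj (w : ℂ) * (z : ℂ)‖ < 1 := by
  rw [norm_mul, Complex.norm_conj]
  nlinarith [w.norm_lt_one, z.norm_lt_one, norm_nonneg (w : ℂ), norm_nonneg (z : ℂ)]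

lemma one_sub_ne_zero_of_norm_lt_one {x : ℂ} (hx : ‖x‖ < 1) : 1 - x ≠ 0 := by
  intro h
  rw [← sub_eq_zero.mp h] at hx
  simp at hx

lemma hasSum_kernelPow (s : ℝ) (z w : Disk) :
    HasSum (fun n : ℕ => ((Ring.choose (s + n - 1) n : ℝ) : ℂ) * (conj (w : ℂ) * (z : ℂ)) ^ n)
      (kernelPow s z w) :=
  hasSum_kernel (norm_conj_mul_lt_one z w)

lemma conj_kernelPow (s : ℝ) (z w : Disk) : conj (kernelPow s z w) = kernelPow s w z := by
  refine ((hasSum_kernelPow s z w).map (starRingEnd ℂ) Complex.continuous_conj).unique ?_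
  convert hasSum_kernelPow s w z using 2 with n
  simp [mul_comm]

lemma kernelPow_zero (z w : Disk) : kernelPow 0 z w = 1 := by simp [kernelPow]

lemma kernelPow_add_one (s : ℝ) (z w : Disk) :
    kernelPow (s + 1) z w = kernelPow s z w / (1 - conj (w : ℂ) * (z : ℂ)) := by
  have h := one_sub_ne_zero_of_norm_lt_one (norm_conj_mul_lt_one z w)
  rw [kernelPow, kernelPow, ofReal_add, ofReal_one, cpow_add _ _ h, cpow_one, div_div]

section quadForm

variable {ι : Type} [Fintype ι] (w : ι → Disk) (c : ι → ℂ)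

lemma quadForm_sub (K L : Disk → Disk → ℂ) :
    quadForm (fun z w => K z w - L z w) w c = quadForm K w c - quadForm L w c := by
  simp only [quadForm, ← Finset.sum_sub_distrib, mul_sub]

lemma quadForm_const_mul (a : ℂ) (K : Disk → Disk → ℂ) :
    quadForm (fun z w => a * K z w) w c = a * quadForm K w c := by
  simp only [quadForm, Finset.mul_sum]
  exact Finset.sum_congr rfl fun i _ => Finset.sum_congr rfl fun j _ => by ring

lemma quadForm_mul_mul (g : Disk → ℂ) (K : Disk → Disk → ℂ) :
    quadForm (fun z w => g z * conj (g w) * K z w) w c =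
      quadForm K w fun i => conj (g (w i)) * c i := by
  simp only [quadForm, map_mul, conj_conj]
  exact Finset.sum_congr rfl fun i _ => Finset.sum_congr rfl fun j _ => by ring

lemma quadForm_rank_one (g : Disk → ℂ) :
    quadForm (fun z w => g z * conj (g w)) w c = (normSq (∑ i, conj (c i) * g (w i)) : ℝ) := by
  rw [← mul_conj, map_sum, Finset.sum_mul_sum, quadForm]
  exact Finset.sum_congr rfl fun i _ => Finset.sum_congr rfl fun j _ => by
    simp only [map_mul, conj_conj]; ring

end quadForm

/-- The Schur product of a positive kernel with `(1 - \bar w z)^(-s)` is positive. -/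
lemma IsPosKernel.mul_kernelPow {P : Disk → Disk → ℂ} (hP : IsPosKernel P) {s : ℝ} (hs : 0 ≤ s) :
    IsPosKernel fun z w => P z w * kernelPow s z w := by
  intro ι _ w c
  -- `multichoose_nonneg` needs s > 0; for s = 0 the factor is identically 1.
  rcases hs.eq_or_lt with rfl | hs
  · simpa [kernelPow_zero] using hP ι w c
  -- Each power (\bar w z)^n is absorbed into the coefficients c, so the form is a nonnegative
  -- combination of forms of P.
  have hsum : HasSum (fun n : ℕ => ((Ring.choose (s + n - 1) n : ℝ) : ℂ) *
      quadForm P w fun i => conj (w i : ℂ) ^ n * c i)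
      (quadForm (fun z w => P z w * kernelPow s z w) w c) := by
    have := hasSum_sum (s := Finset.univ) fun i _ => hasSum_sum (s := Finset.univ) fun j _ =>
      (hasSum_kernelPow s (w i) (w j)).mul_left (conj (c i) * c j * P (w i) (w j))
    have e : quadForm (fun z w => P z w * kernelPow s z w) w c =
        ∑ i, ∑ j, conj (c i) * c j * P (w i) (w j) * kernelPow s (w i) (w j) :=
      Finset.sum_congr rfl fun i _ => Finset.sum_congr rfl fun j _ => (mul_assoc _ _ _).symm
    rw [e]
    refine (congrArg (fun g : ℕ → ℂ => HasSum g _) (funext fun n => ?_)).mp this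
    simp only [quadForm, Finset.mul_sum]
    refine Finset.sum_congr rfl fun i _ => Finset.sum_congr rfl fun j _ => ?_
    simp only [map_mul, map_pow, conj_conj, mul_pow]
    ring
  refine (hsum.mapL reCLM).nonneg fun n => ?_
  rw [reCLM_apply, re_ofReal_mul]
  exact mul_nonneg (multichoose_nonneg hs n) (hP ι w _)

/-- Cauchy–Schwarz inequality for a positive kernel. -/
lemma IsPosKernel.sub_rank_one {P : Disk → Disk → ℂ} (hP : IsPosKernel P)
    (hherm : ∀ z w, conj (P z w) = P w z) (a : Disk) {p : ℝ} (hp : 0 < p) (hpa : P a a = p) :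
    IsPosKernel fun z w => p * P z w - P z a * conj (P w a) := by
  intro ι _ w c
  set L : ℂ := ∑ i, conj (c i) * P (w i) a with hL
  have hconjL : conj L = ∑ j, c j * P a (w j) := by
    simp [hL, map_sum, hherm]
  -- The point a is adjoined with the coefficient that minimizes the enlarged form; the minimum is Q
  -- - |L|²/p, with Q the form of P at c.
  have h := hP (Option ι) (fun o => o.elim a w) (fun o => o.elim (-conj L / p) c)
  have hp' : (p : ℂ) ≠ 0 := by exact_mod_cast hp.ne'
  have e : p * quadForm P (fun o : Option ι => o.elim a w) (fun o => o.elim (-conj L / p) c) =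
      p * quadForm P w c - normSq L := by
    have e1 : ∑ i, conj (c i) * (-conj L / p) * P (w i) a = (-conj L / p) * L := by
      rw [hL, Finset.mul_sum]; exact Finset.sum_congr rfl fun i _ => by ring
    have e2 : ∑ j, conj (-conj L / p) * c j * P a (w j) = (-L / p) * conj L := by
      have e3 : conj (-conj L / p) = -L / p := by simp
      rw [e3, hconjL, Finset.mul_sum]
      exact Finset.sum_congr rfl fun i _ => by ring
    simp only [quadForm, Fintype.sum_option, Option.elim_none, Option.elim_some,
      Finset.sum_add_distrib]
    rw [e1, e2, hpa, ← mul_conj]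
    simp only [map_div₀, map_neg, conj_conj, conj_ofReal]
    field_simp
    ring
  rw [quadForm_sub w c (fun z w => p * P z w) fun z w => P z a * conj (P w a),
    quadForm_const_mul, quadForm_rank_one w c fun z => P z a, ← hL, ← e, re_ofReal_mul]
  positivity

/-! ### Positivity of the de Branges–Rovnyak kernels -/

/-- Cauchy's formula for the Szegő kernel. -/
lemma circleAverage_conj_szego_mul {g : ℂ → ℂ} (hg : DiffContOnCl ℂ g (Metric.ball 0 1))
    (w : Disk) :
    Real.circleAverage (fun ζ => conj (1 / (1 - conj (w : ℂ) * ζ)) * g ζ) 0 1 = g w := by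
  have h := DiffContOnCl.circleAverage_smul_div (c := 0) (R := 1) (w := (w : ℂ)) (by simpa using hg)
    (by simp)
  rw [← h]
  refine Real.circleAverage_congr_sphere fun ζ hζ => ?_
  have hζ1 : ‖ζ‖ = 1 := by simpa using hζ
  have hζ0 : ζ ≠ 0 := by rintro rfl; simp at hζ1
  have hc : conj ζ = ζ⁻¹ := by rw [inv_def, normSq_eq_norm_sq, hζ1]; simp
  have hne : ζ - w ≠ 0 := by
    intro h0
    have := w.norm_lt_one
    rw [← sub_eq_zero.mp h0, hζ1] at this
    exact lt_irrefl _ this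
  simp only [map_div₀, map_one, map_sub, map_mul, conj_conj, hc, sub_zero, smul_eq_mul]
  congr 1
  have : 1 - (w : ℂ) * ζ⁻¹ = (ζ - w) / ζ := by field_simp
  rw [this, one_div_div]

lemma one_sub_conj_mul_ne_zero (w : Disk) {ζ : ℂ} (hζ : ζ ∈ Metric.closedBall (0 : ℂ) 1) :
    1 - conj (w : ℂ) * ζ ≠ 0 := by
  refine one_sub_ne_zero_of_norm_lt_one ?_
  rw [norm_mul, Complex.norm_conj]
  have := w.norm_lt_one
  have h2 : ‖ζ‖ ≤ 1 := by simpa using hζ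
  nlinarith [norm_nonneg (w : ℂ), norm_nonneg ζ]

/-- With S_i the Szegő kernels, x = ∑ c_i S_i and y = ∑ c_i \bar F(w_i) S_i, the form equals ‖x‖² -
‖y‖² in H². Cauchy's formula gives ⟨x, F y⟩ = ‖y‖², so this is the circle average of |x - F y|² +
|y|² - |F y|², which is pointwise nonnegative because |F| ≤ 1. -/
lemma isPosKernel_dbrKernel_of_differentiableOn {F : ℂ → ℂ}
    (hF : DifferentiableOn ℂ F (Metric.closedBall 0 1))
    (hF1 : ∀ z ∈ Metric.closedBall (0 : ℂ) 1, ‖F z‖ ≤ 1) :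
    IsPosKernel (dbrKernel fun z => F z) := by
  intro ι _ w c
  set S : ι → ℂ → ℂ := fun i ζ => 1 / (1 - conj (w i : ℂ) * ζ) with hS
  have hSd (i) : DifferentiableOn ℂ (S i) (Metric.closedBall 0 1) := by
    refine DifferentiableOn.div (by fun_prop) (by fun_prop) fun ζ hζ => ?_
    exact one_sub_conj_mul_ne_zero (w i) hζ
  set x : ℂ → ℂ := fun ζ => ∑ i, c i * S i ζ with hx
  set y : ℂ → ℂ := fun ζ => ∑ i, c i * conj (F (w i)) * S i ζ with hy
  have hxd : DifferentiableOn ℂ x (Metric.closedBall 0 1) :=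
    DifferentiableOn.fun_sum fun i _ => (hSd i).const_mul _
  have hyd : DifferentiableOn ℂ y (Metric.closedBall 0 1) :=
    DifferentiableOn.fun_sum fun i _ => (hSd i).const_mul _
  -- Chosen so that ∑ \bar S_i g_i = |x|² - 2 \bar x F y + |y|² on the circle, with each g_i
  -- holomorphic so that Cauchy's formula evaluates its average at w_i.
  set g : ι → ℂ → ℂ := fun i ζ =>
    conj (c i) * (x ζ - 2 * (F ζ * y ζ)) + conj (c i) * F (w i) * y ζ with hg
  have hgd (i) : DifferentiableOn ℂ (g i) (Metric.closedBall 0 1) :=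
    ((hxd.sub ((hF.mul hyd).const_mul 2)).const_mul _).add (hyd.const_mul _)
  have hcl : closure (Metric.ball (0 : ℂ) 1) = Metric.closedBall 0 1 :=
    closure_ball 0 one_ne_zero
  have hgcl (i) : DiffContOnCl ℂ (g i) (Metric.ball 0 1) := by
    apply DifferentiableOn.diffContOnCl
    rw [hcl]; exact hgd i
  have hsph : Metric.sphere (0 : ℂ) |1| ⊆ Metric.closedBall 0 1 := by
    rw [abs_one]; exact Metric.sphere_subset_closedBall
  have hint (i) : CircleIntegrable (fun ζ => conj (S i ζ) * g i ζ) 0 1 := by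
    refine ContinuousOn.circleIntegrable' ?_
    exact (continuous_conj.comp_continuousOn ((hSd i).continuousOn.mono hsph)).mul
      ((hgd i).continuousOn.mono hsph)
  have hsum : Real.circleAverage (fun ζ => ∑ i, conj (S i ζ) * g i ζ) 0 1 = ∑ i, g i (w i) := by
    rw [Real.circleAverage_fun_sum fun i _ => hint i]
    exact Finset.sum_congr rfl fun i _ => circleAverage_conj_szego_mul (hgcl i) (w i)
  have hquad : ∑ i, g i (w i) = quadForm (dbrKernel fun z => F z) w c := by
    simp only [hg, quadForm, hx, hy, mul_sub, Finset.mul_sum, ← Finset.sum_sub_distrib,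
      ← Finset.sum_add_distrib]
    refine Finset.sum_congr rfl fun i _ => Finset.sum_congr rfl fun j _ => ?_
    simp only [hS, dbrKernel]
    ring
  have hpt (ζ : ℂ) : ∑ i, conj (S i ζ) * g i ζ =
      conj (x ζ) * x ζ - 2 * (conj (x ζ) * (F ζ * y ζ)) + conj (y ζ) * y ζ := by
    have h1 : conj (x ζ) = ∑ i, conj (c i) * conj (S i ζ) := by simp [hx]
    have h2 : conj (y ζ) = ∑ i, conj (c i) * F (w i) * conj (S i ζ) := by simp [hy]
    rw [h1, h2]
    simp only [Finset.sum_mul, Finset.mul_sum, ← Finset.sum_sub_distrib,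
      ← Finset.sum_add_distrib]
    refine Finset.sum_congr rfl fun i _ => ?_
    simp only [hg]
    ring
  have hre (ζ) (hζ : ζ ∈ Metric.sphere (0 : ℂ) |1|) : 0 ≤ (∑ i, conj (S i ζ) * g i ζ).re := by
    have hle : normSq (F ζ * y ζ) ≤ normSq (y ζ) := by
      rw [normSq_mul, normSq_eq_norm_sq (F ζ)]
      have := hF1 ζ (hsph hζ)
      exact mul_le_of_le_one_left (normSq_nonneg _) (pow_le_one₀ (norm_nonneg _) this)
    have h3 : (∑ i, conj (S i ζ) * g i ζ).re =
        normSq (x ζ - F ζ * y ζ) + (normSq (y ζ) - normSq (F ζ * y ζ)) := by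
      rw [hpt, normSq_sub]
      simp only [← normSq_eq_conj_mul_self, sub_re, add_re, ofReal_re, mul_re, conj_re, conj_im,
        mul_im, re_ofNat, im_ofNat]
      ring
    rw [h3]
    have := normSq_nonneg (x ζ - F ζ * y ζ)
    linarith
  have hcomm := ContinuousLinearMap.circleAverage_comp_comm
    (f := fun ζ => ∑ i, conj (S i ζ) * g i ζ) (c := 0) (R := 1) reCLM
    (by simpa using CircleIntegrable.fun_sum (Finset.univ) fun i _ => hint i)
  rw [← hquad, ← hsum, ← reCLM_apply, ← hcomm]
  exact Real.circleAverage_nonneg_of_nonneg hre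

/-- The de Branges–Rovnyak kernel of a function in the unit ball of `H^∞` is positive. -/
lemma InHInftyBall.isPosKernel_dbrKernel {h : Disk → ℂ} (hh : InHInftyBall h) :
    IsPosKernel (dbrKernel h) := by
  obtain ⟨F, hF, hhF⟩ := hh.analytic
  intro ι _ w c
  have hball (r : ℝ) (hr : r ∈ Set.Ioo (0 : ℝ) 1) (z : ℂ) (hz : z ∈ Metric.closedBall (0 : ℂ) 1) :
      (r : ℂ) * z ∈ Metric.ball (0 : ℂ) 1 := by
    have hz1 : ‖z‖ ≤ 1 := by simpa using hz
    rw [mem_ball_zero_iff, norm_mul, norm_real, Real.norm_of_nonneg hr.1.le]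
    nlinarith [hr.1, hr.2, norm_nonneg z]
  -- The dilates F(r z) are holomorphic on the closed disk; positivity passes to the limit r → 1.
  have hpos : ∀ᶠ r : ℝ in 𝓝[<] 1, 0 ≤ (quadForm (dbrKernel fun z => F (r * z)) w c).re := by
    filter_upwards [Ioo_mem_nhdsLT (zero_lt_one (α := ℝ))] with r hr
    refine isPosKernel_dbrKernel_of_differentiableOn (F := fun z => F (r * z)) ?_ ?_ ι w c
    · exact hF.comp (by fun_prop) fun z hz => hball r hr z hz
    · intro z hz
      have := hh.norm_le_one ⟨_, hball r hr z hz⟩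
      rwa [hhF] at this
  have hlim (z : Disk) : Tendsto (fun r : ℝ => F (r * z)) (𝓝[<] 1) (𝓝 (h z)) := by
    rw [hhF]
    have h1 : ContinuousAt F ((1 : ℝ) * (z : ℂ)) := by
      rw [ofReal_one, one_mul]
      exact hF.continuousOn.continuousAt (Metric.isOpen_ball.mem_nhds z.2)
    have h2 : ContinuousAt (fun r : ℝ => F (r * z)) 1 :=
      ContinuousAt.comp (f := fun r : ℝ => (r : ℂ) * z) h1 (by fun_prop)
    have h3 := h2.tendsto
    simp only [ofReal_one, one_mul] at h3
    exact h3.mono_left nhdsWithin_le_nhds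
  have ht : Tendsto (fun r : ℝ => quadForm (dbrKernel fun z => F (r * z)) w c) (𝓝[<] 1)
      (𝓝 (quadForm (dbrKernel h) w c)) := by
    refine tendsto_finsetSum _ fun i _ => tendsto_finsetSum _ fun j _ => ?_
    refine Tendsto.const_mul _ (Tendsto.div_const (Tendsto.const_sub _ ?_) _)
    exact (hlim _).mul ((continuous_conj.tendsto _).comp (hlim _))
  exact ge_of_tendsto ((continuous_re.tendsto _).comp ht) hpos

/-! ### Domination of `A²_{α-1}` by the sub-Bergman kernel -/

/-- The origin of the disk. -/
def Disk.origin : Disk := ⟨0, by simp⟩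

/-- Maximum modulus principle: |b(a)| = 1 would be an interior maximum. -/
lemma InHInftyBall.norm_lt_one_of_nonconst {b : Disk → ℂ} (hb : InHInftyBall b)
    (hb' : ¬ ∃ c : ℂ, ∀ z, b z = c) (a : Disk) : ‖b a‖ < 1 := by
  refine lt_of_le_of_ne (hb.norm_le_one a) fun h1 => hb' ⟨b a, fun z => ?_⟩
  obtain ⟨F, hF, hbF⟩ := hb.analytic
  have := eqOn_of_isPreconnected_of_isMaxOn_norm (f := F) (c := (a : ℂ))
    (convex_ball (0 : ℂ) 1).isPreconnected Metric.isOpen_ball hF a.2 fun z hz => by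
      have h2 := hb.norm_le_one ⟨z, hz⟩
      rw [hbF] at h1 h2
      simpa [h1] using h2
  rw [hbF, hbF]
  exact this z.2

/-- The kernel of `A²_{α-1}` is dominated by a multiple of the kernel of the sub-Bergman space. -/
lemma InHInftyBall.exists_quadForm_kernelPow_le {b : Disk → ℂ} (hb : InHInftyBall b)
    (hb' : ¬ ∃ c : ℂ, ∀ z, b z = c) {α : ℝ} (hα : 0 ≤ α) :
    ∃ C : ℝ, 0 ≤ C ∧ ∀ (ι : Type) [Fintype ι] (w : ι → Disk) (c : ι → ℂ),
      (quadForm (kernelPow (α + 1)) w c).re ≤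
        C * (quadForm (fun z w => (1 - b z * conj (b w)) * kernelPow (α + 2) z w) w c).re := by
  set β : ℂ := b Disk.origin with hβ
  have hβ1 : ‖β‖ < 1 := hb.norm_lt_one_of_nonconst hb' _
  set p : ℝ := 1 - ‖β‖ ^ 2 with hp
  have hp0 : 0 < p := by nlinarith [norm_nonneg β]
  set q : ℝ := 1 - ‖β‖ with hq
  have hq0 : 0 < q := by linarith
  set g : Disk → ℂ := fun z => 1 - b z * conj β with hg
  have hgq (z : Disk) : q ≤ ‖g z‖ := by
    have h1 : ‖b z * conj β‖ ≤ ‖β‖ := by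
      rw [norm_mul, norm_conj]
      exact mul_le_of_le_one_left (norm_nonneg _) (hb.norm_le_one z)
    have h2 := norm_sub_norm_le (1 : ℂ) (b z * conj β)
    rw [norm_one] at h2
    linarith
  have hg0 (z : Disk) : g z ≠ 0 := norm_pos_iff.mp (hq0.trans_le (hgq z))
  -- The lower bound |g| ≥ q makes q/g a function in the unit ball, whose own kernel is therefore
  -- positive.
  have hh : InHInftyBall fun z => q / g z := by
    refine ⟨?_, fun z => ?_⟩
    · obtain ⟨F, hF, hbF⟩ := hb.analytic
      refine ⟨fun z => q / (1 - F z * conj β), ?_, fun z => by simp [hg, hbF]⟩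
      refine DifferentiableOn.div (by fun_prop) ((hF.mul_const _).const_sub _) fun z hz => ?_
      simpa [hg, hbF] using hg0 ⟨z, hz⟩
    · rw [norm_div, norm_real, Real.norm_of_nonneg hq0.le, div_le_one (hq0.trans_le (hgq z))]
      exact hgq z
  have hherm (z w : Disk) : conj (dbrKernel b z w) = dbrKernel b w z := by
    simp only [dbrKernel, map_div₀, map_sub, map_one, map_mul, conj_conj, mul_comm]
  have horig (z : Disk) : dbrKernel b z Disk.origin = g z := by
    have h0 : ((Disk.origin : Disk) : ℂ) = 0 := rfl
    simp [dbrKernel, hg, h0, hβ]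
  have h1 := (hb.isPosKernel_dbrKernel.sub_rank_one hherm Disk.origin hp0 (by
    rw [horig, hg, hp]; simp only [← hβ, mul_conj, normSq_eq_norm_sq]; push_cast; rfl)).mul_kernelPow
    (s := α + 1) (by linarith)
  have h2 := hh.isPosKernel_dbrKernel.mul_kernelPow hα
  refine ⟨p / q ^ 2, by positivity, fun ι _ w c => ?_⟩
  have h1' := h1 ι w c
  -- These coefficients multiply the kernel by g(z) \bar g(w), which clears the denominators of q/g.
  have h2' := h2 ι w fun i => conj (g (w i)) * c i
  have hk (z w : Disk) := one_sub_ne_zero_of_norm_lt_one (norm_conj_mul_lt_one z w)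
  have e1 : (fun z w => (p * dbrKernel b z w - dbrKernel b z Disk.origin *
        conj (dbrKernel b w Disk.origin)) * kernelPow (α + 1) z w) =
      fun z w => p * ((1 - b z * conj (b w)) * kernelPow (α + 2) z w) -
        g z * conj (g w) * kernelPow (α + 1) z w := by
    funext z w
    rw [horig, horig, show α + 2 = (α + 1) + 1 by ring, kernelPow_add_one (α + 1), dbrKernel]
    ring
  have e2 : (fun z w => g z * conj (g w) *
        (dbrKernel (fun z => q / g z) z w * kernelPow α z w)) =
      fun z w => g z * conj (g w) * kernelPow (α + 1) z w - (q ^ 2 : ℝ) * kernelPow (α + 1) z w := by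
    funext z w
    have h3 := hg0 z
    have h4 : conj (g w) ≠ 0 := (map_ne_zero _).mpr (hg0 w)
    have h5 := hk z w
    rw [kernelPow_add_one α, dbrKernel]
    simp only [map_div₀, conj_ofReal]
    push_cast
    field_simp
  rw [e1, quadForm_sub w c (fun z w => p * ((1 - b z * conj (b w)) * kernelPow (α + 2) z w))
    (fun z w => g z * conj (g w) * kernelPow (α + 1) z w), quadForm_const_mul, sub_re,
    re_ofReal_mul] at h1'
  rw [← quadForm_mul_mul, e2, quadForm_sub w c
    (fun z w => g z * conj (g w) * kernelPow (α + 1) z w)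
    (fun z w => (q ^ 2 : ℝ) * kernelPow (α + 1) z w), quadForm_const_mul, sub_re,
    re_ofReal_mul] at h2'
  rw [div_mul_eq_mul_div, le_div_iff₀ (by positivity)]
  linarith

/-- Functions in `A²_{γ}` are dominated by the kernel. -/
lemma exists_normSq_le_of_mem_kernelSpace {γ : ℝ} {hγ : -1 ≤ γ} {f : Disk → ℂ}
    (hf : f ∈ kernelSpace γ hγ) :
    ∃ C : ℝ, 0 ≤ C ∧ ∀ (ι : Type) [Fintype ι] (w : ι → Disk) (c : ι → ℂ),
      ‖∑ i, conj (c i) * f (w i)‖ ^ 2 ≤ C * (quadForm (kernelPow (γ + 2)) w c).re := by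
  have : Fact (kernel γ).PosSemidef := ⟨kernel_posSemidef hγ⟩
  obtain ⟨F, rfl⟩ := hf
  refine ⟨‖F‖ ^ 2, by positivity, fun ι _ w c => ?_⟩
  -- Pairing F with this combination of kernel functions gives the sum to be bounded, and ‖x‖² is
  -- the quadratic form; Cauchy–Schwarz concludes.
  set x : RKHS.OfKernel (kernel γ) := ∑ i, RKHS.kerFun (RKHS.OfKernel (kernel γ)) (w i) (c i)
    with hx
  have h1 : ⟪x, F⟫_ℂ = ∑ i, conj (c i) * F (w i) := by
    rw [hx, sum_inner]
    exact Finset.sum_congr rfl fun i _ => by rw [RKHS.kerFun_inner, RCLike.inner_apply, mul_comm]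
  have h2 : ⟪x, x⟫_ℂ = quadForm (kernelPow (γ + 2)) w c := by
    rw [hx, sum_inner]
    simp only [inner_sum, RKHS.kerFun_inner, RKHS.kerFun_apply, RKHS.OfKernel.kernel_ofKernel]
    refine Finset.sum_congr rfl fun i _ => Finset.sum_congr rfl fun j _ => ?_
    have e : (kernel γ (w i) (w j)) (c j) = kernelPow (γ + 2) (w i) (w j) * c j := by
      simp [kernel, kernelPow]
    rw [e, RCLike.inner_apply]
    ring
  rw [← h1, ← h2]
  have h3 : (⟪x, x⟫_ℂ).re = ‖x‖ ^ 2 := inner_self_eq_norm_sq (𝕜 := ℂ) x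
  rw [h3, ← mul_pow, mul_comm]
  exact pow_le_pow_left₀ (norm_nonneg _) (norm_inner_le_norm _ _) 2


/-! ### Integration in polar coordinates -/

lemma integral_eq_integral_circleAverage {G : ℂ → ℂ} (hG : Integrable G) :
    ∫ z, G z = ∫ r in Set.Ioi (0 : ℝ), (2 * Real.pi * r) • Real.circleAverage G 0 r := by
  have hsymm (p : ℝ × ℝ) : Complex.polarCoord.symm p = circleMap 0 p.1 p.2 := by
    simp [circleMap, Complex.polarCoord_symm_apply, Complex.exp_mul_I]
  -- Fubini needs integrability in polar coordinates, obtained from the change of variables with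
  -- Jacobian r.
  have hint : IntegrableOn (fun p : ℝ × ℝ => p.1 • G (Complex.polarCoord.symm p))
      polarCoord.target := by
    have h1 : Integrable (fun p => G (measurableEquivRealProd.symm p)) :=
      (Complex.volume_preserving_equiv_real_prod.symm _).integrable_comp_of_integrable hG
    have h2 := (h1.integrableOn (s := polarCoord.symm '' polarCoord.target))
    rw [integrableOn_image_iff_integrableOn_abs_det_fderiv_smul volume
      polarCoord.open_target.measurableSet
      (fun p _ => (hasFDerivAt_polarCoord_symm p).hasFDerivWithinAt)
      polarCoord.symm.injOn] at h2
    refine h2.congr_fun (fun p hp => ?_) polarCoord.open_target.measurableSet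
    have hp1 : 0 < p.1 := hp.1
    simp only [det_fderivPolarCoordSymm, abs_of_pos hp1]
    rfl
  rw [← Complex.integral_comp_polarCoord_symm, polarCoord_target, Measure.volume_eq_prod,
    setIntegral_prod]
  · refine setIntegral_congr_fun measurableSet_Ioi fun r _ => ?_
    have hpi := Real.pi_pos
    simp only [hsymm]
    rw [integral_smul, Real.circleAverage_eq_integral_add (-Real.pi),
      intervalIntegral.integral_comp_add_right (fun θ => G (circleMap 0 r θ)),
      show (0 : ℝ) + -Real.pi = -Real.pi by ring,
      show 2 * Real.pi + -Real.pi = Real.pi by ring,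
      intervalIntegral.integral_of_le (by linarith), integral_Ioc_eq_integral_Ioo, smul_smul]
    congr 1
    field_simp
  · rw [polarCoord_target, Measure.volume_eq_prod] at hint
    exact hint

lemma measurable_areaDensity (α : ℝ) : Measurable fun z : Disk =>
    ENNReal.ofReal ((α + 1) * (1 - ‖(z : ℂ)‖ ^ 2) ^ α / Real.pi) := by
  fun_prop

lemma one_sub_sq_nonneg (z : Disk) : 0 ≤ 1 - ‖(z : ℂ)‖ ^ 2 := by
  nlinarith [z.norm_lt_one, norm_nonneg (z : ℂ)]

lemma integral_areaMeasure {α : ℝ} (hα : -1 < α) {f : ℂ → ℂ}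
    (hf : Integrable (fun z : Disk => f z) (areaMeasure α)) :
    ∫ z : Disk, f z ∂areaMeasure α =
      ∫ r in Set.Ioo (0 : ℝ) 1,
        (2 * (α + 1) * r * (1 - r ^ 2) ^ α) • Real.circleAverage f 0 r := by
  have hpi := Real.pi_pos
  set wt : ℂ → ℝ := fun z => (α + 1) * (1 - ‖z‖ ^ 2) ^ α / Real.pi with hwt
  have hwt0 (z : Disk) : 0 ≤ wt z :=
    div_nonneg (mul_nonneg (by linarith) (Real.rpow_nonneg (one_sub_sq_nonneg z) _)) hpi.le
  set G : ℂ → ℂ := (Metric.ball 0 1).indicator fun z => wt z • f z with hG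
  have hGint : Integrable G := by
    rw [areaMeasure, integrable_withDensity_iff_integrable_smul' (measurable_areaDensity α)
      (Eventually.of_forall fun _ => ENNReal.ofReal_lt_top)] at hf
    rw [hG, integrable_indicator_iff measurableSet_ball,
      integrableOn_iff_comap_subtypeVal measurableSet_ball]
    refine hf.congr (Eventually.of_forall fun z => ?_)
    exact congrArg (· • f z) (ENNReal.toReal_ofReal (hwt0 z))
  have h1 : ∫ z : Disk, f z ∂areaMeasure α = ∫ z, G z := by
    rw [areaMeasure, integral_withDensity_eq_integral_toReal_smul (measurable_areaDensity α)
      (Eventually.of_forall fun _ => ENNReal.ofReal_lt_top), hG,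
      integral_indicator measurableSet_ball, ← integral_subtype_comap measurableSet_ball]
    exact integral_congr_ae (Eventually.of_forall fun z =>
      congrArg (· • f z) (ENNReal.toReal_ofReal (hwt0 z)))
  rw [h1, integral_eq_integral_circleAverage hGint]
  have h2 (r : ℝ) (hr : r ∈ Set.Ioi (0 : ℝ)) :
      (2 * Real.pi * r) • Real.circleAverage G 0 r = (Set.Ioo (0 : ℝ) 1).indicator (fun r =>
        (2 * (α + 1) * r * (1 - r ^ 2) ^ α) • Real.circleAverage f 0 r) r := by
    have hr0 : 0 < r := hr
    by_cases hr1 : r < 1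
    · rw [Set.indicator_of_mem (Set.mem_Ioo.mpr ⟨hr0, hr1⟩)]
      have : Real.circleAverage G 0 r =
          Real.circleAverage (((α + 1) * (1 - r ^ 2) ^ α / Real.pi : ℝ) • f) 0 r := by
        refine Real.circleAverage_congr_sphere fun z hz => ?_
        have hz1 : ‖z‖ = r := by simpa [abs_of_pos hr0] using hz
        rw [hG, Set.indicator_of_mem (by simpa [hz1] using hr1)]
        simp [hwt, hz1]
      rw [this, Real.circleAverage_smul, smul_smul]
      congr 1
      field_simp
    · rw [Set.indicator_of_notMem fun h => hr1 h.2]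
      have : Real.circleAverage G 0 r = Real.circleAverage (fun _ => (0 : ℂ)) 0 r := by
        refine Real.circleAverage_congr_sphere fun z hz => ?_
        have hz1 : ‖z‖ = r := by simpa [abs_of_pos hr0] using hz
        rw [hG, Set.indicator_of_notMem (by simpa [hz1] using hr1)]
      rw [this, Real.circleAverage_const, smul_zero]
  rw [setIntegral_congr_fun measurableSet_Ioi h2, setIntegral_indicator measurableSet_Ioo]
  congr 2
  ext x
  simp only [Set.mem_inter_iff, Set.mem_Ioi, Set.mem_Ioo]
  tauto

/-! ### Moments -/

/-- On |z| = r one has \bar z = r²/z, so the average of \bar z^n F is r^(2n) times Cauchy's integral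
for the n-th Taylor coefficient. -/
lemma exists_coeff {F : ℂ → ℂ} (hF : DifferentiableOn ℂ F (Metric.ball 0 1)) :
    ∃ a : ℕ → ℂ, (∀ z ∈ Metric.ball (0 : ℂ) 1, HasSum (fun n => a n * z ^ n) (F z)) ∧
      ∀ r ∈ Set.Ioo (0 : ℝ) 1, ∀ n : ℕ,
        Real.circleAverage (fun z => conj z ^ n * F z) 0 r = (r : ℂ) ^ (2 * n) * a n := by
  have hps (r : NNReal) (hr : 0 < r) (hr1 : r < 1) :
      HasFPowerSeriesOnBall F (cauchyPowerSeries F 0 r) 0 r := by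
    refine DifferentiableOn.hasFPowerSeriesOnBall (hF.mono ?_) hr
    exact Metric.closedBall_subset_ball (by exact_mod_cast hr1)
  have h2 : (0 : NNReal) < 1 / 2 := by norm_num
  have h21 : (1 / 2 : NNReal) < 1 := by
    rw [← NNReal.coe_lt_coe]; norm_num
  set p := cauchyPowerSeries F 0 ((1 / 2 : NNReal) : ℝ) with hp
  -- Uniqueness of the expansion at 0 makes the Cauchy coefficients independent of the radius; 1/2
  -- is an arbitrary reference.
  have huniq (r : NNReal) (hr : 0 < r) (hr1 : r < 1) : cauchyPowerSeries F 0 r = p :=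
    (hps r hr hr1).hasFPowerSeriesAt.eq_formalMultilinearSeries
      (hps _ h2 h21).hasFPowerSeriesAt
  refine ⟨p.coeff, fun z hz => ?_, fun r hr n => ?_⟩
  · have hz1 : ‖z‖₊ < 1 := by
      rw [← NNReal.coe_lt_coe]; simpa using hz
    obtain ⟨r, hr, hr1⟩ := exists_between hz1
    have h := (hps r (zero_le.trans_lt hr) hr1).hasSum (y := z) (by
      rw [Metric.mem_eball, edist_zero_right, enorm_eq_nnnorm]; exact_mod_cast hr)
    rw [huniq r (zero_le.trans_lt hr) hr1, zero_add] at h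
    simpa [FormalMultilinearSeries.apply_eq_pow_smul_coeff, mul_comm] using h
  · have hr0 : (r : ℂ) ≠ 0 := by exact_mod_cast hr.1.ne'
    have h := huniq ⟨r, hr.1.le⟩ hr.1 hr.2
    rw [← h, FormalMultilinearSeries.coeff]
    have e : (1 : Fin n → ℂ) = fun _ => 1 := rfl
    rw [e, cauchyPowerSeries_apply, Real.circleAverage_eq_circleIntegral hr.1.ne']
    rw [smul_eq_mul, smul_eq_mul, mul_left_comm, ← circleIntegral.integral_const_mul ((r : ℂ) ^ (2 * n))]
    refine congrArg _ ?_
    refine circleIntegral.integral_congr hr.1.le fun z hz => ?_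
    have hz1 : ‖z‖ = r := by simpa using hz
    have hz0 : z ≠ 0 := by
      rintro rfl
      exact hr.1.ne (by simpa using hz1)
    have hc : conj z = r ^ 2 / z := by
      rw [eq_div_iff hz0, ← normSq_eq_conj_mul_self, normSq_eq_norm_sq, hz1]
      push_cast; rfl
    simp only [hc, sub_zero, smul_eq_mul]
    rw [div_pow, div_pow, one_pow, ← pow_mul]
    ring

lemma intervalIntegrable_moment {α : ℝ} (hα : 0 ≤ α) (k : ℕ) :
    IntervalIntegrable (fun r : ℝ => r ^ k * (1 - r ^ 2) ^ α) volume 0 1 := by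
  refine Continuous.intervalIntegrable ?_ _ _
  exact (by fun_prop : Continuous fun r : ℝ => r ^ k).mul
    ((by fun_prop : Continuous fun r : ℝ => 1 - r ^ 2).rpow_const fun _ => Or.inr hα)

/-- The integrand is the derivative of r^k (1 - r²)^(α+1), which vanishes at 1 and equals 0^k at 0.
For k = 0 the truncated exponent k - 1 is harmless, being multiplied by k. -/
lemma integral_deriv_moment {α : ℝ} (hα : 0 ≤ α) (k : ℕ) :
    ∫ r in (0 : ℝ)..1, ((k : ℝ) * r ^ (k - 1) * (1 - r ^ 2) ^ (α + 1) -
      2 * (α + 1) * (r ^ (k + 1) * (1 - r ^ 2) ^ α)) = -(0 : ℝ) ^ k := by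
  have hd (r : ℝ) : HasDerivAt (fun r : ℝ => r ^ k * (1 - r ^ 2) ^ (α + 1))
      ((k : ℝ) * r ^ (k - 1) * (1 - r ^ 2) ^ (α + 1) -
        2 * (α + 1) * (r ^ (k + 1) * (1 - r ^ 2) ^ α)) r := by
    have h1 := (hasDerivAt_pow 2 r).const_sub 1
    have h2 := (hasDerivAt_pow k r).mul (h1.rpow_const (p := α + 1) (Or.inr (by linarith)))
    refine h2.congr_deriv ?_
    rw [add_sub_cancel_right]
    push_cast
    ring
  rw [intervalIntegral.integral_eq_sub_of_hasDerivAt fun r _ => hd r]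
  · have : α + 1 ≠ 0 := by linarith
    simp [this]
  · refine Continuous.intervalIntegrable ?_ _ _
    have hc (s : ℝ) (hs : 0 ≤ s) : Continuous fun r : ℝ => (1 - r ^ 2) ^ s :=
      (by fun_prop : Continuous fun r : ℝ => 1 - r ^ 2).rpow_const fun _ => Or.inr hs
    have h1 := hc α hα
    have h2 := hc (α + 1) (by linarith)
    fun_prop

lemma moment_zero {α : ℝ} (hα : 0 ≤ α) :
    2 * (α + 1) * ∫ r in (0 : ℝ)..1, r * (1 - r ^ 2) ^ α = 1 := by
  have h := integral_deriv_moment hα 0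
  simp only [Nat.cast_zero, zero_mul, zero_sub, zero_add, pow_one, pow_zero] at h
  rw [intervalIntegral.integral_neg, intervalIntegral.integral_const_mul] at h
  linarith

/-- Integration by parts with k = 2(n+1), after splitting off one factor 1 - r² from (1 - r²)^(α+1).
-/
lemma moment_succ {α : ℝ} (hα : 0 ≤ α) (n : ℕ) :
    (n + 1 + α + 1) * ∫ r in (0 : ℝ)..1, r ^ (2 * (n + 1) + 1) * (1 - r ^ 2) ^ α =
      (n + 1) * ∫ r in (0 : ℝ)..1, r ^ (2 * n + 1) * (1 - r ^ 2) ^ α := by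
  have h := integral_deriv_moment hα (2 * (n + 1))
  have e : ∫ r in (0 : ℝ)..1, (((2 * (n + 1) : ℕ) : ℝ) * r ^ (2 * (n + 1) - 1) *
        (1 - r ^ 2) ^ (α + 1) - 2 * (α + 1) * (r ^ (2 * (n + 1) + 1) * (1 - r ^ 2) ^ α)) =
      ∫ r in (0 : ℝ)..1, (2 * (n + 1) * (r ^ (2 * n + 1) * (1 - r ^ 2) ^ α) -
        2 * (n + 1 + α + 1) * (r ^ (2 * (n + 1) + 1) * (1 - r ^ 2) ^ α)) := by
    refine intervalIntegral.integral_congr fun r hr => ?_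
    rw [Set.uIcc_of_le zero_le_one] at hr
    have h0 : 0 ≤ 1 - r ^ 2 := by nlinarith [hr.1, hr.2]
    have h1 : (1 - r ^ 2) ^ (α + 1) = (1 - r ^ 2) ^ α * (1 - r ^ 2) := by
      rw [Real.rpow_add_of_nonneg h0 hα zero_le_one, Real.rpow_one]
    simp only [h1, show 2 * (n + 1) - 1 = 2 * n + 1 by omega]
    push_cast
    ring
  rw [e, intervalIntegral.integral_sub ((intervalIntegrable_moment hα _).const_mul _)
    ((intervalIntegrable_moment hα _).const_mul _), intervalIntegral.integral_const_mul,
    intervalIntegral.integral_const_mul] at h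
  rw [zero_pow (by omega)] at h
  linarith

/-- The moments of the weight are the inverses of the coefficients of the kernel. -/
lemma choose_mul_moment {α : ℝ} (hα : 0 ≤ α) (n : ℕ) :
    Ring.choose (α + 2 + n - 1) n *
      (2 * (α + 1) * ∫ r in (0 : ℝ)..1, r ^ (2 * n + 1) * (1 - r ^ 2) ^ α) = 1 := by
  have hchoose : (n.factorial : ℝ) * Ring.choose (α + 2 + n - 1) n =
      (ascPochhammer ℝ n).eval (α + 2) := by
    have h := Ring.factorial_nsmul_multichoose_eq_ascPochhammer (α + 2) n
    rwa [Ring.multichoose_eq, Polynomial.ascPochhammer_smeval_eq_eval, nsmul_eq_mul] at h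
  -- Multiplying by n! replaces the binomial coefficient by a rising factorial, whose recursion
  -- cancels that of the moments.
  have key : ∀ n : ℕ, (ascPochhammer ℝ n).eval (α + 2) *
      (2 * (α + 1) * ∫ r in (0 : ℝ)..1, r ^ (2 * n + 1) * (1 - r ^ 2) ^ α) = n.factorial := by
    intro n
    induction n with
    | zero => simpa using moment_zero hα
    | succ n ih =>
      rw [ascPochhammer_succ_eval, Nat.factorial_succ]
      push_cast
      rw [← ih]
      have := moment_succ hα n
      linear_combination (ascPochhammer ℝ n).eval (α + 2) * 2 * (α + 1) * this
  have h := key n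
  rw [← hchoose, mul_assoc] at h
  have hn : (n.factorial : ℝ) ≠ 0 := by positivity
  exact mul_left_cancel₀ hn (by rw [h, mul_one])

/-! ### The reproducing formula -/

/-- For α ≥ 0 the density is at most (α + 1)/π. Finiteness puts bounded functions in L² and L²
functions in L¹. -/
instance isFiniteMeasure_areaMeasure {α : ℝ} [hα : Fact (0 ≤ α)] :
    IsFiniteMeasure (areaMeasure α) := by
  have hα := hα.out
  refine isFiniteMeasure_withDensity ?_
  have h1 : ∀ z : Disk, ENNReal.ofReal ((α + 1) * (1 - ‖(z : ℂ)‖ ^ 2) ^ α / Real.pi) ≤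
      ENNReal.ofReal ((α + 1) / Real.pi) := fun z => by
    have hpi := Real.pi_pos
    refine ENNReal.ofReal_le_ofReal ?_
    gcongr
    refine mul_le_of_le_one_right (by linarith) (Real.rpow_le_one (one_sub_sq_nonneg z) ?_ hα)
    nlinarith [norm_nonneg (z : ℂ)]
  refine ne_top_of_le_ne_top ?_ (lintegral_mono h1)
  rw [lintegral_const]
  refine ENNReal.mul_ne_top ENNReal.ofReal_ne_top ?_
  have := (MeasurableEmbedding.subtype_coe (measurableSet_ball (x := (0 : ℂ)) (ε := 1))).comap_apply
    (μ := volume) Set.univ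
  rw [this, Set.image_univ, Subtype.range_coe]
  exact measure_ball_lt_top.ne

/-- The integral of `\bar z^n F(z)` extracts the `n`-th Taylor coefficient of `F`. -/
lemma integral_conj_pow_mul {α : ℝ} (hα : 0 ≤ α) {F : ℂ → ℂ} {a : ℕ → ℂ} (n : ℕ)
    (ha : ∀ r ∈ Set.Ioo (0 : ℝ) 1,
        Real.circleAverage (fun z => conj z ^ n * F z) 0 r = (r : ℂ) ^ (2 * n) * a n)
    (hint : Integrable (fun z : Disk => conj (z : ℂ) ^ n * F z) (areaMeasure α)) :
    (Ring.choose (α + 2 + n - 1) n : ℝ) * ∫ z : Disk, conj (z : ℂ) ^ n * F z ∂areaMeasure α =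
      a n := by
  have h := choose_mul_moment hα n
  rw [integral_areaMeasure (by linarith) (f := fun z => conj z ^ n * F z) hint]
  have e : ∫ r in Set.Ioo (0 : ℝ) 1, (2 * (α + 1) * r * (1 - r ^ 2) ^ α) •
        Real.circleAverage (fun z => conj z ^ n * F z) 0 r =
      ((2 * (α + 1) * ∫ r in (0 : ℝ)..1, r ^ (2 * n + 1) * (1 - r ^ 2) ^ α : ℝ) : ℂ) * a n := by
    rw [← intervalIntegral.integral_const_mul, intervalIntegral.integral_of_le zero_le_one,
      integral_Ioc_eq_integral_Ioo, ← integral_complex_ofReal, ← integral_mul_const]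
    refine setIntegral_congr_fun measurableSet_Ioo fun r hr => ?_
    simp only [ha r hr, real_smul]
    push_cast
    ring
  rw [e, ← mul_assoc, ← ofReal_mul, h, ofReal_one, one_mul]

/-- The reproducing formula for the weighted Bergman spaces. -/
lemma integral_conj_kernelPow_mul {α : ℝ} (hα : 0 ≤ α) {F : ℂ → ℂ}
    (hF : DifferentiableOn ℂ F (Metric.ball 0 1))
    (hint : Integrable (fun z : Disk => F z) (areaMeasure α)) (w : Disk) :
    ∫ z : Disk, conj (kernelPow (α + 2) z w) * F z ∂areaMeasure α = F w := by
  obtain ⟨a, ha, hcoeff⟩ := exists_coeff hF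
  set c : ℕ → ℝ := fun n => Ring.choose (α + 2 + n - 1) n with hc
  have hc0 (n) : 0 ≤ c n := multichoose_nonneg (by linarith) n
  have hintn (n : ℕ) : Integrable (fun z : Disk => conj (z : ℂ) ^ n * F z) (areaMeasure α) := by
    refine hint.bdd_mul (c := 1) (by fun_prop) (Eventually.of_forall fun z => ?_)
    simpa using pow_le_one₀ (norm_nonneg _) z.norm_lt_one.le
  have hterm (n : ℕ) (z : Disk) : (c n : ℂ) * (conj (z : ℂ) * (w : ℂ)) ^ n * F z =
      (c n * (w : ℂ) ^ n) * (conj (z : ℂ) ^ n * F z) := by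
    rw [mul_pow]; ring
  -- Since |z| < 1, the n-th term is at most c_n |w|^n |F(z)|; this majorant justifies integrating
  -- the series termwise.
  have hsw : Summable fun n : ℕ => c n * ‖(w : ℂ)‖ ^ n := by
    have := (hasSum_kernel (s := α + 2) (x := (‖(w : ℂ)‖ : ℂ))
      (by simpa using w.norm_lt_one)).summable.norm
    refine this.congr fun n => ?_
    rw [norm_mul, norm_pow, norm_real, norm_real, norm_norm, Real.norm_of_nonneg (hc0 n)]
  have hs := hasSum_integral_of_summable_integral_norm (μ := areaMeasure α)
    (F := fun n (z : Disk) => (c n : ℂ) * (conj (z : ℂ) * (w : ℂ)) ^ n * F z)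
    (fun n => by
      simp only [hterm]
      exact (hintn n).const_mul _)
    (by
      refine Summable.of_nonneg_of_le (fun n => integral_nonneg fun z => norm_nonneg _)
        (fun n => ?_) (hsw.mul_right (∫ z : Disk, ‖F z‖ ∂areaMeasure α))
      rw [← integral_const_mul]
      refine integral_mono_of_nonneg (Eventually.of_forall fun z => norm_nonneg _)
        (hint.norm.const_mul _) (Eventually.of_forall fun z => ?_)
      simp only [norm_mul, norm_pow, norm_conj, norm_real, Real.norm_of_nonneg (hc0 n)]
      have h1 : ‖(z : ℂ)‖ * ‖(w : ℂ)‖ ≤ ‖(w : ℂ)‖ :=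
        mul_le_of_le_one_left (norm_nonneg _) z.norm_lt_one.le
      have := hc0 n
      gcongr)
  have h1 (n : ℕ) : ∫ z : Disk, (c n : ℂ) * (conj (z : ℂ) * (w : ℂ)) ^ n * F z ∂areaMeasure α =
      a n * (w : ℂ) ^ n := by
    simp only [hterm]
    rw [integral_const_mul, ← integral_conj_pow_mul hα n (fun r hr => hcoeff r hr n) (hintn n)]
    ring
  have h2 (z : Disk) : ∑' n, (c n : ℂ) * (conj (z : ℂ) * (w : ℂ)) ^ n * F z =
      conj (kernelPow (α + 2) z w) * F z := by
    rw [conj_kernelPow]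
    exact ((hasSum_kernelPow (α + 2) w z).mul_right (F z)).tsum_eq
  simp only [h1, h2] at hs
  exact hs.unique (ha w w.2)


/-! ### Solving a moment problem in a Hilbert space -/

/-- The bound says that ∑ c_i e_i ↦ ∑ c_i \bar f_i is a well-defined functional of norm at most √C
on the span of the e_i. Hahn–Banach extends it and Riesz represents it. -/
lemma exists_inner_eq_of_bound {H ι : Type*} [NormedAddCommGroup H] [InnerProductSpace ℂ H]
    [CompleteSpace H] (e : ι → H) (f : ι → ℂ) {C : ℝ} (hC : 0 ≤ C)
    (h : ∀ c : ι →₀ ℂ, ‖c.sum fun i a => conj a * f i‖ ^ 2 ≤ C * ‖c.sum fun i a => a • e i‖ ^ 2) :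
    ∃ x : H, ∀ i, ⟪e i, x⟫_ℂ = f i := by
  set E : (ι →₀ ℂ) →ₗ[ℂ] H := Finsupp.linearCombination ℂ e with hE
  set φ : (ι →₀ ℂ) →ₗ[ℂ] ℂ := Finsupp.linearCombination ℂ fun i => conj (f i) with hφ
  have hbound (c : ι →₀ ℂ) : ‖φ c‖ ≤ √C * ‖E c‖ := by
    have h1 : φ c = conj (c.sum fun i a => conj a * f i) := by
      simp [hφ, Finsupp.linearCombination_apply, Finsupp.sum]
    have h2 := h c
    rw [← norm_conj, ← h1] at h2
    refine le_of_sq_le_sq ?_ (by positivity)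
    rw [mul_pow, Real.sq_sqrt hC]
    exact h2
  -- A linear choice of coefficients for each vector of the span; the choice is immaterial because φ
  -- vanishes on the kernel of E.
  obtain ⟨s, hs⟩ := E.rangeRestrict.exists_rightInverse_of_surjective E.range_rangeRestrict
  have hEs (y : LinearMap.range E) : E (s y) = y := congrArg Subtype.val (LinearMap.congr_fun hs y)
  obtain ⟨g, hg, -⟩ := exists_extension_norm_eq (LinearMap.range E)
    ((φ ∘ₗ s).mkContinuous √C fun y => by simpa [hEs] using hbound (s y))
  refine ⟨(InnerProductSpace.toDual ℂ H).symm g, fun i => ?_⟩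
  have hei : E (Finsupp.single i 1) = e i := by simp [hE]
  have hmem : e i ∈ LinearMap.range E := ⟨_, hei⟩
  have h0 : φ (s ⟨e i, hmem⟩) = φ (Finsupp.single i 1) := by
    have := hbound (s ⟨e i, hmem⟩ - Finsupp.single i 1)
    rw [map_sub, map_sub, hEs, hei, sub_self, norm_zero, mul_zero] at this
    exact sub_eq_zero.mp (norm_le_zero_iff.mp this)
  rw [← inner_conj_symm, InnerProductSpace.toDual_symm_apply]
  have h1 : g (e i) = φ (s ⟨e i, hmem⟩) := hg ⟨e i, hmem⟩
  rw [h1, h0]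
  simp [hφ]

/-! ### Defect operators and their positive square roots -/

section Hilbert

variable {H : Type*} [NormedAddCommGroup H] [InnerProductSpace ℂ H]

lemma inner_one_sub_comp {T S : H →L[ℂ] H} (hTS : ∀ u v, ⟪T u, v⟫_ℂ = ⟪u, S v⟫_ℂ) (u v : H) :
    ⟪u, (1 - T ∘L S) v⟫_ℂ = ⟪u, v⟫_ℂ - ⟪S u, S v⟫_ℂ := by
  have : (1 - T ∘L S) v = v - T (S v) := rfl
  rw [this, inner_sub_right, ← inner_conj_symm u (T _), hTS, inner_conj_symm]

/-- If `T* k = \bar β k`, in weak form, then `S k = \bar β k` for the adjoint `S` of `T`. -/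
lemma adjoint_eigenvector {T S : H →L[ℂ] H} (hTS : ∀ u v, ⟪T u, v⟫_ℂ = ⟪u, S v⟫_ℂ) {k : H} {β : ℂ}
    (hk : ∀ u, ⟪k, T u⟫_ℂ = β * ⟪k, u⟫_ℂ) : S k = conj β • k := by
  refine ext_inner_right ℂ fun u => ?_
  rw [← inner_conj_symm, ← hTS, inner_conj_symm, hk, inner_smul_left, conj_conj]

lemma inner_one_sub_comp_eigenvectors {T S : H →L[ℂ] H} (hTS : ∀ u v, ⟪T u, v⟫_ℂ = ⟪u, S v⟫_ℂ)
    {k l : H} {β γ : ℂ} (hk : ∀ u, ⟪k, T u⟫_ℂ = β * ⟪k, u⟫_ℂ)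
    (hl : ∀ u, ⟪l, T u⟫_ℂ = γ * ⟪l, u⟫_ℂ) :
    ⟪k, (1 - T ∘L S) l⟫_ℂ = (1 - β * conj γ) * ⟪k, l⟫_ℂ := by
  rw [inner_one_sub_comp hTS, adjoint_eigenvector hTS hk, adjoint_eigenvector hTS hl,
    inner_smul_left, inner_smul_right, conj_conj]
  ring

lemma one_sub_comp_nonneg {T S : H →L[ℂ] H} (hTS : ∀ u v, ⟪T u, v⟫_ℂ = ⟪u, S v⟫_ℂ)
    (hS : ∀ u, ‖S u‖ ≤ ‖u‖) : 0 ≤ 1 - T ∘L S := by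
  rw [ContinuousLinearMap.nonneg_iff_isPositive]
  refine ⟨fun u v => ?_, fun u => ?_⟩
  · change ⟪(1 - T ∘L S) u, v⟫_ℂ = ⟪u, (1 - T ∘L S) v⟫_ℂ
    rw [← inner_conj_symm, inner_one_sub_comp hTS, inner_one_sub_comp hTS, map_sub,
      inner_conj_symm, inner_conj_symm]
  · rw [ContinuousLinearMap.reApplyInnerSelf_apply, ← inner_re_symm, inner_one_sub_comp hTS,
      map_sub, inner_self_eq_norm_sq, inner_self_eq_norm_sq, sub_nonneg]
    exact pow_le_pow_left₀ (norm_nonneg _) (hS u) 2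

variable [CompleteSpace H]

lemma inner_opSqrt (D : H →L[ℂ] H) (u v : H) : ⟪opSqrt D u, v⟫_ℂ = ⟪u, opSqrt D v⟫_ℂ :=
  ((ContinuousLinearMap.nonneg_iff_isPositive _).mp (CFC.sqrt_nonneg D)).inner_left_eq_inner_right
    u v

lemma norm_opSqrt_sq {D : H →L[ℂ] H} (hD : 0 ≤ D) (u : H) :
    ‖opSqrt D u‖ ^ 2 = (⟪u, D u⟫_ℂ).re := by
  have h : D u = opSqrt D (opSqrt D u) :=
    (DFunLike.congr_fun (CFC.sqrt_mul_sqrt_self D hD) u).symm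
  rw [h, ← inner_opSqrt]
  exact (inner_self_eq_norm_sq (𝕜 := ℂ) _).symm

/-- A function dominated by the kernel `⟪k z, D k w⟫` is represented by an element of the range of
`D^{1/2}`. -/
lemma exists_opSqrt_inner_eq {D : H →L[ℂ] H} (hD : 0 ≤ D) {k : Disk → H}
    {M : Disk → Disk → ℂ} (hM : ∀ z w, ⟪k z, D (k w)⟫_ℂ = M z w) {f : Disk → ℂ} {C : ℝ}
    (hC : 0 ≤ C) (hf : ∀ (ι : Type) [Fintype ι] (w : ι → Disk) (c : ι → ℂ),
      ‖∑ i, conj (c i) * f (w i)‖ ^ 2 ≤ C * (quadForm M w c).re) :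
    ∃ x : H, ∀ w, ⟪k w, opSqrt D x⟫_ℂ = f w := by
  -- The vectors D^{1/2} k_w have Gram matrix M, so the hypothesis on f is exactly the solvability
  -- bound.
  obtain ⟨x, hx⟩ := exists_inner_eq_of_bound (fun w => opSqrt D (k w)) f hC fun c => by
    set v : c.support → Disk := fun i => i with hv
    set d : c.support → ℂ := fun i => c i with hd
    have e1 : (c.sum fun i a => conj a * f i) = ∑ i, conj (d i) * f (v i) :=
      (Finset.sum_coe_sort c.support fun i => conj (c i) * f i).symm
    have e2 : (c.sum fun i a => a • opSqrt D (k i)) = opSqrt D (∑ i, d i • k (v i)) := by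
      rw [map_sum]
      simp only [map_smul]
      exact (Finset.sum_coe_sort c.support fun i => c i • opSqrt D (k i)).symm
    have e3 : ⟪∑ i, d i • k (v i), D (∑ i, d i • k (v i))⟫_ℂ = quadForm M v d := by
      rw [map_sum, sum_inner]
      refine Finset.sum_congr rfl fun i _ => ?_
      rw [inner_sum]
      refine Finset.sum_congr rfl fun j _ => ?_
      rw [map_smul, inner_smul_left, inner_smul_right, hM]
      ring
    rw [e1, e2, norm_opSqrt_sq hD, e3]
    exact hf _ v d
  exact ⟨x, fun w => by rw [← hx w, inner_opSqrt]⟩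

end Hilbert

/-! ### Reproducing kernels and Toeplitz operators -/

lemma isAnalytic_kernelPow (s : ℝ) (w : Disk) : IsAnalytic fun z => kernelPow s z w := by
  refine ⟨fun z => 1 / (1 - conj (w : ℂ) * z) ^ (s : ℂ), ?_, fun _ => rfl⟩
  -- The base has positive real part and so avoids the branch cut of the power.
  have hre (z : ℂ) (hz : z ∈ Metric.ball (0 : ℂ) 1) : 1 - conj (w : ℂ) * z ∈ slitPlane := by
    refine Or.inl ?_
    have h1 := norm_conj_mul_lt_one ⟨z, hz⟩ w
    have h2 := re_le_norm (conj (w : ℂ) * z)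
    rw [sub_re, one_re]
    simp only at h1
    linarith
  refine DifferentiableOn.div (by fun_prop) ?_ fun z hz => ?_
  · exact DifferentiableOn.cpow (by fun_prop) (by fun_prop) hre
  · exact cpow_ne_zero_iff.mpr (Or.inl (slitPlane_ne_zero (hre z hz)))

lemma norm_kernelPow_le (s : ℝ) (w : Disk) :
    ∃ C : ℝ, ∀ z : Disk, ‖kernelPow s z w‖ ≤ C := by
  have h := (hasSum_kernel (s := s) (x := (‖(w : ℂ)‖ : ℂ)) (by simpa using w.norm_lt_one)).summable.norm
  refine ⟨∑' n : ℕ, ‖((Ring.choose (s + n - 1) n : ℝ) : ℂ) * (‖(w : ℂ)‖ : ℂ) ^ n‖, fun z => ?_⟩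
  rw [← (hasSum_kernelPow s z w).tsum_eq]
  refine tsum_of_norm_bounded h.hasSum fun n => ?_
  simp only [norm_mul, norm_pow, norm_conj, norm_real, norm_norm]
  gcongr
  exact mul_le_of_le_one_right (norm_nonneg _) z.norm_lt_one.le

lemma memLp_kernelPow {α : ℝ} (hα : 0 ≤ α) (w : Disk) :
    MemLp (fun z => kernelPow (α + 2) z w) 2 (areaMeasure α) := by
  have : Fact (0 ≤ α) := ⟨hα⟩
  obtain ⟨C, hC⟩ := norm_kernelPow_le (α + 2) w
  exact MemLp.of_bound (isAnalytic_kernelPow _ w).continuous.aestronglyMeasurable C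
    (Eventually.of_forall hC)

/-- The reproducing kernel of the weighted Bergman space. -/
noncomputable def bergmanKernel {α : ℝ} (hα : 0 ≤ α) (w : Disk) : bergman α :=
  ⟨(memLp_kernelPow hα w).toLp _, _, isAnalytic_kernelPow (α + 2) w,
    (memLp_kernelPow hα w).coeFn_toLp⟩

lemma coeFn_bergmanKernel {α : ℝ} (hα : 0 ≤ α) (w : Disk) :
    ((bergmanKernel hα w : bergman α) : Lp ℂ 2 (areaMeasure α)) =ᵐ[areaMeasure α]
      fun z => kernelPow (α + 2) z w :=
  (memLp_kernelPow hα w).coeFn_toLp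

/-- Elements of L² are classes, so point values are taken on an analytic representative f. -/
lemma inner_bergmanKernel_eq {α : ℝ} (hα : 0 ≤ α) (w : Disk) {u : Lp ℂ 2 (areaMeasure α)}
    {f : Disk → ℂ} (hf : IsAnalytic f) (huf : u =ᵐ[areaMeasure α] f) :
    ⟪((bergmanKernel hα w : bergman α) : Lp ℂ 2 (areaMeasure α)), u⟫_ℂ = f w := by
  have : Fact (0 ≤ α) := ⟨hα⟩
  obtain ⟨F, hF, hfF⟩ := hf
  obtain rfl : f = fun z : Disk => F z := funext hfF
  have hint : Integrable (fun z : Disk => F z) (areaMeasure α) :=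
    (((memLp_congr_ae huf).mp (Lp.memLp u)).integrable (by norm_num))
  rw [L2.inner_def, hfF w, ← integral_conj_kernelPow_mul hα hF hint w]
  refine integral_congr_ae ?_
  filter_upwards [huf, coeFn_bergmanKernel hα w] with z h1 h2
  rw [h1, h2, RCLike.inner_apply, mul_comm]

lemma coeFn_mulOp {α : ℝ} {φ : Disk → ℂ} (hφ : MemLp φ ∞ (areaMeasure α))
    (u : Lp ℂ 2 (areaMeasure α)) :
    mulOp α φ hφ u =ᵐ[areaMeasure α] fun z => φ z * u z := by
  have h1 : mulOp α φ hφ u =ᵐ[areaMeasure α] fun z => hφ.toLp φ z * u z :=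
    (ContinuousLinearMap.mul ℂ ℂ).coeFn_holder (hφ.toLp φ) u
  filter_upwards [h1, hφ.coeFn_toLp] with z h1 h2
  rw [h1, h2]

lemma inner_mulOp_left {α : ℝ} {φ : Disk → ℂ} (hφ : MemLp φ ∞ (areaMeasure α))
    (hφ' : MemLp (fun z => conj (φ z)) ∞ (areaMeasure α)) (u v : Lp ℂ 2 (areaMeasure α)) :
    ⟪mulOp α φ hφ u, v⟫_ℂ = ⟪u, mulOp α (fun z => conj (φ z)) hφ' v⟫_ℂ := by
  rw [L2.inner_def, L2.inner_def]
  refine integral_congr_ae ?_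
  filter_upwards [coeFn_mulOp hφ u, coeFn_mulOp hφ' v] with z h1 h2
  rw [h1, h2, RCLike.inner_apply, RCLike.inner_apply, map_mul]
  ring

lemma inner_toeplitz_right {α : ℝ} {φ : Disk → ℂ} (hφ : MemLp φ ∞ (areaMeasure α))
    (u v : bergman α) :
    ⟪u, toeplitz α φ hφ v⟫_ℂ = ⟪(u : Lp ℂ 2 (areaMeasure α)), mulOp α φ hφ v⟫_ℂ :=
  Submodule.inner_orthogonalProjectionOnto_eq_of_mem_left u _

/-! ### The defect operator of b on kernel functions -/

section defect

variable {α : ℝ} {b : Disk → ℂ} (hb : InHInftyBall b)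

lemma InHInftyBall.inner_toeplitz_left (u v : bergman α) :
    ⟪toeplitz α b (hb.memLp α) u, v⟫_ℂ =
      ⟪u, toeplitz α (fun z => conj (b z)) (hb.memLp_conj α) v⟫_ℂ :=
  ((bergman α).inner_orthogonalProjectionOnto_eq_of_mem_right v _).trans
    ((inner_mulOp_left (hb.memLp α) (hb.memLp_conj α) (u : Lp ℂ 2 (areaMeasure α)) v).trans
      (inner_toeplitz_right (hb.memLp_conj α) u v).symm)

/-- The product of b with an analytic representative of u is already analytic, so pairing with the
kernel evaluates it at w. This is the weak form of T_b^* k_w = \bar b(w) k_w. -/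
lemma InHInftyBall.inner_bergmanKernel_toeplitz (hα : 0 ≤ α) (w : Disk) (u : bergman α) :
    ⟪bergmanKernel hα w, toeplitz α b (hb.memLp α) u⟫_ℂ = b w * ⟪bergmanKernel hα w, u⟫_ℂ := by
  obtain ⟨f, ⟨F, hF, hfF⟩, huf⟩ := u.2
  obtain ⟨B, hB, hbB⟩ := hb.analytic
  have h1 : mulOp α b (hb.memLp α) u =ᵐ[areaMeasure α] fun z => b z * f z := by
    filter_upwards [coeFn_mulOp (hb.memLp α) (u : Lp ℂ 2 (areaMeasure α)), huf] with z h1 h2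
    rw [h1, h2]
  have h2 : ⟪bergmanKernel hα w, u⟫_ℂ = f w := inner_bergmanKernel_eq hα w ⟨F, hF, hfF⟩ huf
  rw [inner_toeplitz_right, h2,
    inner_bergmanKernel_eq hα w ⟨fun z => B z * F z, hB.mul hF, fun z => by rw [hbB, hfF]⟩ h1]

lemma InHInftyBall.norm_toeplitz_conj_le (u : bergman α) :
    ‖toeplitz α (fun z => conj (b z)) (hb.memLp_conj α) u‖ ≤ ‖u‖ := by
  refine ((bergman α).orthogonalProjectionOnto.le_opNorm _).trans ?_
  refine (mul_le_of_le_one_left (norm_nonneg _)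
    (bergman α).orthogonalProjectionOnto_norm_le).trans ?_
  refine Lp.norm_le_norm_of_ae_le ?_
  filter_upwards [coeFn_mulOp (hb.memLp_conj α) (u : Lp ℂ 2 (areaMeasure α))] with z h
  have h1 : ‖(mulOp α (fun z => conj (b z)) (hb.memLp_conj α) u : Lp ℂ 2 (areaMeasure α)) z‖ ≤
      ‖(u : Lp ℂ 2 (areaMeasure α)) z‖ := by
    rw [h, norm_mul, norm_conj]
    exact mul_le_of_le_one_left (norm_nonneg _) (hb.norm_le_one z)
  exact h1

lemma InHInftyBall.defect_nonneg : 0 ≤ defect α b hb :=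
  one_sub_comp_nonneg hb.inner_toeplitz_left hb.norm_toeplitz_conj_le

lemma InHInftyBall.inner_defect_bergmanKernel (hα : 0 ≤ α) (z w : Disk) :
    ⟪bergmanKernel hα z, defect α b hb (bergmanKernel hα w)⟫_ℂ =
      (1 - b z * conj (b w)) * kernelPow (α + 2) z w := by
  have h : ⟪bergmanKernel hα z, bergmanKernel hα w⟫_ℂ = kernelPow (α + 2) z w :=
    inner_bergmanKernel_eq hα z (isAnalytic_kernelPow _ w) (coeFn_bergmanKernel hα w)
  rw [← h]
  exact inner_one_sub_comp_eigenvectors hb.inner_toeplitz_left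
    (hb.inner_bergmanKernel_toeplitz hα z) (hb.inner_bergmanKernel_toeplitz hα w)

end defect

end SubBergman

theorem theorem3 (b : SubBergman.Disk → ℂ) (hb : SubBergman.InHInftyBall b)
    (hb_nonconst : ¬ ∃ c : ℂ, ∀ z, b z = c) (α : ℝ) (hα : 0 ≤ α) :
    SubBergman.kernelSpace (α - 1) (by linarith) ⊆ SubBergman.subBergman α b hb := by
  open SubBergman in
  intro f hf
  obtain ⟨C₁, hC₁, h₁⟩ := exists_normSq_le_of_mem_kernelSpace hf
  obtain ⟨C₂, hC₂, h₂⟩ := hb.exists_quadForm_kernelPow_le hb_nonconst hα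
  obtain ⟨x, hx⟩ := exists_opSqrt_inner_eq hb.defect_nonneg (hb.inner_defect_bergmanKernel hα)
    (mul_nonneg hC₁ hC₂) fun ι _ w c => by
      have h := h₁ ι w c
      rw [show α - 1 + 2 = α + 1 by ring] at h
      rw [mul_assoc]
      exact h.trans (mul_le_mul_of_nonneg_left (h₂ ι w c) hC₁)
  -- The analytic representative g of D^{1/2} x agrees with f at every point by the reproducing
  -- property; this is also what shows f to be analytic.
  obtain ⟨g, hg, hxg⟩ := (opSqrt (defect α b hb) x).2
  obtain rfl : f = g := funext fun w =>
    (hx w).symm.trans (inner_bergmanKernel_eq hα w hg hxg)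
  exact ⟨hg, _, ⟨x, rfl⟩, hxg⟩
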